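/- Let $c\ge 1$ be an integer and $\mu,\nu\in\mathbb R$ with $\mu\ne 0$; put $e(t)=e^{2\pi i t}$ and $\lambda_p(x,y)=(x+2p\mu,y+2p\nu)$ on $\mathbb R\times\mathbb T$. Let $D$ be the quantum Heisenberg manifold $D^c_{\mu\nu}$: the norm closure, in the crossed product of $C_b(\mathbb R\times\mathbb T)$ by $\lambda$ with product $(\Phi*\Psi)(m,p)=\sum_q\Phi(m,q)\Psi(\lambda_{-q}m,p-q)$ and involution $\Phi^*(m,p)=\overline{\Phi(\lambda_{-p}m,-p)}$, of the continuous functions $\Phi(x,y,p)$ on $\mathbb R\times\mathbb T\times\mathbb Z$ that are finitely supported in $p$ and satisfy $\overline{e(ckp(y-p\nu))}\,\Phi(x+k,y,p)=\Phi(x,y,p)$ for all $k\in\mathbb Z$. Let $D^\infty$ be the subalgebra of those $\Phi\in D$ for which $(r,s,t)\mapsto L_{(r,s,t)}\Phi$, $(L_{(r,s,t)}\Phi)(x,y,p)=e(p(t+cs(x-r-p\mu)))\Phi(x-r,y-s,p)$, is norm-smooth on $\mathbb R^3$. Let $\mathfrak h$ be the real Heisenberg Lie algebra with basis $X,Y,Z$,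 $[X,Y]=cZ$, $Z$ central, acting on $D^\infty$ by the derivations $$\delta_X\Phi=2\pi i c p(x-p\mu)\Phi-\partial_y\Phi,\quad \delta_Y\Phi=-\partial_x\Phi,\quad \delta_Z\Phi=2\pi i p\,\Phi .$$ Let $\Xi^\infty$ be the space of Schwartz functions on $\mathbb R\times\mathbb T$, with $$\langle f,g\rangle_D(x,y,p)=\sum_{k\in\mathbb Z}\overline{e(ckp(y-p\nu))}\,f(x+k,y)\,\overline{g(x-2p\mu+k,y-2p\nu)},$$ $$\langle f,g\rangle_E(x,y,p)=\sum_{k\in\mathbb Z}e(cpk(y-k\nu))\,\overline{f(x-2k\mu,y-2k\nu)}\,g(x-2k\mu+p,y-2k\nu),$$ $$(g\cdot\Phi)(m)=\sum_{q\in\mathbb Z}g(\lambda_q m)\,\overline{\Phi(\lambda_q m,q)},$$ and let $\nabla^0$ be the connection on $\Xi^\infty$, linear in the $\mathfrak h$-variable, given by $$\nabla^0_X\xi=-\partial_y\xi+\tfrac{\pi c i}{2\mu}x^2\xi,\qquad \nabla^0_Y\xi=-\partial_x\xi,\qquad \nabla^0_Z\xi=\tfrac{\pi i x}{\mu}\xi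 .$$ Let $R\in\Xi^\infty$ satisfy $\langle R,R\rangle_E(x,y,p)=\delta_0(p)$, and put $Q=\langle R,R\rangle_D$. Then $Q$ is a projection in $D^\infty$, and $F(\xi)=\langle R,\xi\rangle_D$ is a bijection from $\Xi^\infty$ onto $QD^\infty$ with inverse $f\mapsto R\cdot f$. Moreover, $\xi\cdot\Phi\in\Xi^\infty$, $F(\xi\cdot\Phi)=F(\xi)*\Phi$ and $\langle\xi,\eta\rangle_D=F(\xi)^**F(\eta)$ for all $\xi,\eta\in\Xi^\infty$ and $\Phi\in D^\infty$. Let $\nabla'_V=F\circ\nabla^0_V\circ F^{-1}$ for $V\in\mathfrak h$. (a) $\nabla'$ is a linear connection on the right $D^\infty$-module $QD^\infty$, over $\delta$, that is compatible with the inner product $(f,g)\mapsto f^**g$, and $$\nabla'_V f=\langle R,\nabla^0_V(R\cdot f)\rangle_D\qquad(V\in\mathfrak h,\ f\in QD^\infty).$$ (b) For all $V,W\in\mathfrak h$ there is a unique $\Theta'(V,W)\in QD^\infty Q$ such that $\nabla'_V\nabla'_W f-\nabla'_W\nabla'_V f-\nabla'_{[V,W]}f=\Theta'(V,W)*f$ for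 all $f\in QD^\infty$, and $$\Theta'(X,Y)=0,\qquad \Theta'(X,Z)=0,\qquad \Theta'(Y,Z)=\frac{\pi i}{\mu}\,Q .$$ -/

import Mathlib

noncomputable section

open scoped ContDiff ComplexConjugate

namespace QHM

/-- `e(t) = exp(2πit)`. -/
def e (t : ℝ) : ℂ := Complex.exp (2 * Real.pi * Complex.I * t)

/-- The flow `λ_p(x, y) = (x + 2pμ, y + 2pν)`. Functions on `ℝ × 𝕋` are written throughout as
functions on `ℝ × ℝ` that have period 1 in the second variable. -/
def flow (μ ν : ℝ) (p : ℤ) (m : ℝ × ℝ) : ℝ × ℝ := (m.1 + 2 * p * μ, m.2 + 2 * p * ν)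

/-! ### The crossed product and the quantum Heisenberg manifold

Elements of (subalgebras of) the crossed product of `C_b(ℝ × 𝕋)` by the flow are written through
their coefficient functions `Φ(x, y, p)`. -/

/-- The product of the crossed product: `(Φ ∗ Ψ)(m, p) = ∑_q Φ(m, q) Ψ(λ_{-q} m, p - q)`. -/
def conv (μ ν : ℝ) (Φ Ψ : ℝ × ℝ → ℤ → ℂ) : ℝ × ℝ → ℤ → ℂ :=
  fun m p => ∑' q : ℤ, Φ m q * Ψ (flow μ ν (-q) m) (p - q)

/-- The involution of the crossed product: `Φ^*(m, p)` is the conjugate of `Φ(λ_{-p} m, -p)`. -/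
def adj (μ ν : ℝ) (Φ : ℝ × ℝ → ℤ → ℂ) : ℝ × ℝ → ℤ → ℂ :=
  fun m p => conj (Φ (flow μ ν (-p) m) (-p))

/-- The Hilbert space of the regular representation of the crossed product which is induced from
the (faithful) representation of `C_b(ℝ × 𝕋)` by multiplication operators on `ℓ²(ℝ × ℝ)`. -/
abbrev Hilb : Type := lp (fun _ : (ℝ × ℝ) × ℤ => ℂ) 2

/-- The operator `T` represents `Φ` in the regular representation:
`(T ξ)(m, n) = ∑_q Φ(λ_n m, q) ξ(m, n - q)`. As `ℤ` is amenable, the operator norm here is the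
norm of the crossed product. -/
def Represents (μ ν : ℝ) (T : Hilb →L[ℂ] Hilb) (Φ : ℝ × ℝ → ℤ → ℂ) : Prop :=
  ∀ (ξ : Hilb) (m : ℝ × ℝ) (n : ℤ),
    HasSum (fun q : ℤ => Φ (flow μ ν n m) q * ξ (m, n - q)) (T ξ (m, n))

/-- The `∗`-algebra `D_0`: continuous functions on `ℝ × 𝕋 × ℤ`, finitely supported in the last
variable, which are fixed by all `ρ_k`, where
`(ρ_k Φ)(x, y, p) = conj(e(ckp(y - pν))) Φ(x + k, y, p)`. -/
def DZero (c : ℕ) (ν : ℝ) : Set (ℝ × ℝ → ℤ → ℂ) :=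
  {Φ | (∀ p, Continuous fun m => Φ m p) ∧
    (∀ x y p, Φ (x, y + 1) p = Φ (x, y) p) ∧
    {p | ∃ m, Φ m p ≠ 0}.Finite ∧
    ∀ (k : ℤ) (x y : ℝ) (p : ℤ),
      conj (e (c * k * p * (y - p * ν))) * Φ (x + k, y) p = Φ (x, y) p}

/-- The C*-algebra `D` (the quantum Heisenberg manifold): the norm closure of `D_0`. -/
def D (c : ℕ) (μ ν : ℝ) : Set (ℝ × ℝ → ℤ → ℂ) :=
  {Φ | ∃ T : Hilb →L[ℂ] Hilb, Represents μ ν T Φ ∧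
    T ∈ closure {S | ∃ Ψ ∈ DZero c ν, Represents μ ν S Ψ}}

/-- The action of the reparametrized Heisenberg group on `D`:
`(L_{(r,s,t)} Φ)(x, y, p) = e(p(t + cs(x - r - pμ))) Φ(x - r, y - s, p)`. -/
def groupAct (c : ℕ) (μ : ℝ) (h : ℝ × ℝ × ℝ) (Φ : ℝ × ℝ → ℤ → ℂ) : ℝ × ℝ → ℤ → ℂ :=
  fun m p => e (p * (h.2.2 + c * h.2.1 * (m.1 - h.1 - p * μ))) * Φ (m.1 - h.1, m.2 - h.2.1) p

/-- The smooth subalgebra `D^∞`: the elements `Φ` of `D` for which `h ↦ L_h Φ` is smooth for the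
C*-norm. -/
def DSmooth (c : ℕ) (μ ν : ℝ) : Set (ℝ × ℝ → ℤ → ℂ) :=
  {Φ | Φ ∈ D c μ ν ∧ ∃ T : ℝ × ℝ × ℝ → (Hilb →L[ℂ] Hilb),
    (∀ h, Represents μ ν (T h) (groupAct c μ h Φ)) ∧ ContDiff ℝ ∞ T}

/-! ### The Heisenberg Lie algebra and its action by derivations -/

/-- The Heisenberg Lie algebra of strictly upper triangular real `3 × 3` matrices. -/
def heis : Submodule ℝ (Matrix (Fin 3) (Fin 3) ℝ) where
  carrier := {A | ∀ i j, j ≤ i → A i j = 0}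
  add_mem' := by
    intro A B hA hB i j hij
    simp [hA i j hij, hB i j hij]
  zero_mem' := by
    intro i j _
    rfl
  smul_mem' := by
    intro r A hA i j hij
    simp [hA i j hij]

theorem mul_apply_eq_zero (V W : heis) (i j : Fin 3) (hij : j ≤ i) : (V.1 * W.1) i j = 0 := by
  rw [Matrix.mul_apply]
  refine Finset.sum_eq_zero fun k _ => ?_
  rcases le_total k i with h | h
  · rw [V.2 i k h, zero_mul]
  · rw [W.2 k j (hij.trans h), mul_zero]

/-- The Lie bracket of the Heisenberg Lie algebra: the matrix commutator. -/
def bracket (V W : heis) : heis :=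
  ⟨V.1 * W.1 - W.1 * V.1, by
    intro i j hij
    rw [Matrix.sub_apply, mul_apply_eq_zero V W i j hij, mul_apply_eq_zero W V i j hij, sub_zero]⟩

/-- The basis element `X` of the Heisenberg Lie algebra. -/
def basisX : heis :=
  ⟨!![0, 1, 0; 0, 0, 0; 0, 0, 0], by
    intro i j hij; fin_cases i <;> fin_cases j <;> simp_all⟩

/-- The basis element `Y` of the Heisenberg Lie algebra. -/
def basisY : heis :=
  ⟨!![0, 0, 0; 0, 0, 1; 0, 0, 0], by
    intro i j hij; fin_cases i <;> fin_cases j <;> simp_all⟩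

/-- The basis element `Z` of the Heisenberg Lie algebra, so that `[X, Y] = cZ`. -/
def basisZ (c : ℕ) : heis :=
  ⟨!![0, 0, 1 / (c : ℝ); 0, 0, 0; 0, 0, 0], by
    intro i j hij; fin_cases i <;> fin_cases j <;> simp_all⟩

/-- The `X`-coordinate of an element of the Heisenberg Lie algebra. -/
def coordX (V : heis) : ℂ := ((V.1 0 1 : ℝ) : ℂ)

/-- The `Y`-coordinate of an element of the Heisenberg Lie algebra. -/
def coordY (V : heis) : ℂ := ((V.1 1 2 : ℝ) : ℂ)

/-- The `Z`-coordinate of an element of the Heisenberg Lie algebra. -/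
def coordZ (c : ℕ) (V : heis) : ℂ := ((c * V.1 0 2 : ℝ) : ℂ)

/-- The derivation `δ_V` of `D^∞`, for `V` in the Heisenberg Lie algebra; it is linear in `V`, with
`δ_X Φ = 2πicp(x - pμ)Φ - ∂Φ/∂y`, `δ_Y Φ = -∂Φ/∂x` and `δ_Z Φ = 2πipΦ`. -/
def delta (c : ℕ) (μ : ℝ) (V : heis) (Φ : ℝ × ℝ → ℤ → ℂ) : ℝ × ℝ → ℤ → ℂ :=
  fun m p =>
    coordX V * (2 * Real.pi * Complex.I * c * p * (m.1 - p * μ) * Φ m p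
      - deriv (fun y : ℝ => Φ (m.1, y) p) m.2)
    + coordY V * (-deriv (fun x : ℝ => Φ (x, m.2) p) m.1)
    + coordZ c V * (2 * Real.pi * Complex.I * p * Φ m p)

/-! ### The bimodule -/

/-- The smooth bimodule `Ξ^∞`: Schwartz functions on `ℝ × 𝕋`. -/
def Xi : Set (ℝ × ℝ → ℂ) :=
  {f | ContDiff ℝ ∞ f ∧ (∀ x y, f (x, y + 1) = f (x, y)) ∧
    ∀ k n : ℕ, ∃ C : ℝ, ∀ m : ℝ × ℝ, |m.1| ^ k * ‖iteratedFDeriv ℝ n f m‖ ≤ C}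

/-- The `D`-valued inner product on `Ξ`; it is conjugate linear in the second variable. -/
def innerD (c : ℕ) (μ ν : ℝ) (f g : ℝ × ℝ → ℂ) : ℝ × ℝ → ℤ → ℂ :=
  fun m p => ∑' k : ℤ, conj (e (c * k * p * (m.2 - p * ν))) * f (m.1 + k, m.2)
    * conj (g (m.1 - 2 * p * μ + k, m.2 - 2 * p * ν))

/-- The `E`-valued inner product on `Ξ`, where `E` is the other algebra of the bimodule. -/
def innerE (c : ℕ) (μ ν : ℝ) (f g : ℝ × ℝ → ℂ) : ℝ × ℝ → ℤ → ℂ :=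
  fun m p => ∑' k : ℤ, e (c * p * k * (m.2 - k * ν))
    * conj (f (m.1 - 2 * k * μ, m.2 - 2 * k * ν))
    * g (m.1 - 2 * k * μ + p, m.2 - 2 * k * ν)

/-- The identity `(x, y, p) ↦ δ_0(p)` of `E`. -/
def idE : ℝ × ℝ → ℤ → ℂ := fun _ p => if p = 0 then 1 else 0

/-- The right action of `D` on `Ξ`:
`(g · Φ)(m) = ∑_q g(λ_q m) conj(Φ(λ_q m, q))`. -/
def actD (μ ν : ℝ) (g : ℝ × ℝ → ℂ) (Φ : ℝ × ℝ → ℤ → ℂ) : ℝ × ℝ → ℂ :=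
  fun m => ∑' q : ℤ, g (flow μ ν q m) * conj (Φ (flow μ ν q m) q)

/-- The set `Q D^∞`. -/
def QD (c : ℕ) (μ ν : ℝ) (Q : ℝ × ℝ → ℤ → ℂ) : Set (ℝ × ℝ → ℤ → ℂ) :=
  {f | ∃ d ∈ DSmooth c μ ν, f = conv μ ν Q d}

/-- The set `Q D^∞ Q`. -/
def QDQ (c : ℕ) (μ ν : ℝ) (Q : ℝ × ℝ → ℤ → ℂ) : Set (ℝ × ℝ → ℤ → ℂ) :=
  {f | ∃ d ∈ DSmooth c μ ν, f = conv μ ν (conv μ ν Q d) Q}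

/-! ### Connections -/

/-- `nab` is a linear connection, over the derivations `δ` of `D^∞`, on the right `D^∞`-module `S`
with action `act`, and it is compatible with the `D`-valued inner product `ip`. -/
structure IsCompatibleConnection {M : Type} [AddCommGroup M] [Module ℂ M] (c : ℕ) (μ ν : ℝ)
    (S : Set M) (act : M → (ℝ × ℝ → ℤ → ℂ) → M) (ip : M → M → (ℝ × ℝ → ℤ → ℂ))
    (nab : heis → M → M) : Prop where
  maps : ∀ V, ∀ ξ ∈ S, nab V ξ ∈ S
  map_add : ∀ V, ∀ ξ ∈ S, ∀ η ∈ S, nab V (ξ + η) = nab V ξ + nab V η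
  map_smul : ∀ V, ∀ a : ℂ, ∀ ξ ∈ S, nab V (a • ξ) = a • nab V ξ
  add_left : ∀ V W, ∀ ξ ∈ S, nab (V + W) ξ = nab V ξ + nab W ξ
  smul_left : ∀ (r : ℝ) V, ∀ ξ ∈ S, nab (r • V) ξ = (r : ℂ) • nab V ξ
  leibniz : ∀ V, ∀ ξ ∈ S, ∀ Φ ∈ DSmooth c μ ν,
    nab V (act ξ Φ) = act (nab V ξ) Φ + act ξ (delta c μ V Φ)
  compatible : ∀ V, ∀ ξ ∈ S, ∀ η ∈ S,
    delta c μ V (ip ξ η) = ip (nab V ξ) η + ip ξ (nab V η)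

/-- The curvature operator `∇_V ∇_W - ∇_W ∇_V - ∇_{[V,W]}`. -/
def curvOp {M : Type} [AddCommGroup M] (nab : heis → M → M) (V W : heis) (ξ : M) : M :=
  nab V (nab W ξ) - nab W (nab V ξ) - nab (bracket V W) ξ

/-- The connection `∇^0` on `Ξ^∞`; it is linear in `V`, with
`∇^0_X ξ = -∂ξ/∂y + (πci/2μ)x²ξ`, `∇^0_Y ξ = -∂ξ/∂x` and `∇^0_Z ξ = (πix/μ)ξ`. -/
def nablaZero (c : ℕ) (μ : ℝ) (V : heis) (ξ : ℝ × ℝ → ℂ) : ℝ × ℝ → ℂ :=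
  fun m =>
    coordX V * (-deriv (fun y : ℝ => ξ (m.1, y)) m.2
      + Real.pi * c * Complex.I / (2 * μ) * m.1 ^ 2 * ξ m)
    + coordY V * (-deriv (fun x : ℝ => ξ (x, m.2)) m.1)
    + coordZ c V * (Real.pi * Complex.I * m.1 / μ * ξ m)

/-- The connection `∇' = F ∘ ∇^0 ∘ F⁻¹` on `Q D^∞` which corresponds to `∇^0` under the map
`F ξ = ⟨R, ξ⟩_D` from `Ξ^∞` to `Q D^∞`. -/
def nablaPrime (c : ℕ) (μ ν : ℝ) (R : ℝ × ℝ → ℂ) (V : heis) (f : ℝ × ℝ → ℤ → ℂ) :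
    ℝ × ℝ → ℤ → ℂ :=
  innerD c μ ν R (nablaZero c μ V (Function.invFunOn (innerD c μ ν R) Xi f))

end QHM

end

noncomputable section

open scoped ContDiff ComplexConjugate

namespace QHM

/-! ### The character `e` -/

/-! Everything is computed on `Xi` and carried to the module over the smooth algebra by F(ξ) = ⟨R,
ξ⟩_D. The algebra rests on two identities. One is ⟨f, g·Φ⟩_D = ⟨f, g⟩_D ∗ Φ (`innerD_actD`). The
other is R·⟨R, g⟩_D = g (`actD_innerD`), which is the imprimitivity relation combined with ⟨R, R⟩_E
= 1. With ⟨f, g⟩_D^* = ⟨g, f⟩_D they show that Q is a projection, that F is a bijection onto Q D^∞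
with inverse f ↦ R·f, and that F preserves inner products.

The connection ∇^0 obeys the Leibniz rule (`nablaZero_actD`) and is compatible with ⟨·,·⟩_D
(`delta_innerD`): differences of the potentials x² and x at points 2pμ apart produce the
multiplication terms of δ_X and δ_Z. Its curvature is scalar (`nablaZero_curvature`): [-∂_x, πix/μ]
= -πi/μ, while the commutator of ∇^0_X and ∇^0_Y is exactly c∇^0_Z. Since F is conjugate linear,
this imaginary scalar changes sign and Θ'(Y,Z) = (πi/μ)Q. Evaluating at f = Q gives uniqueness,
because T ∗ Q = T on Q D^∞ Q.

Two analytic facts remain. Inner products are smooth (`innerD_mem_DSmooth`): their span is stable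
under the derivations and decays in p. A bootstrap in a weighted sup norm
(`contDiff_toBdd_groupAct`) makes orbits smooth, and the bounded linear map `opFam` passes this to
operators. Conversely ξ·Φ is Schwartz (`actD_mem_Xi`): matrix entries turn norm-smoothness of the
orbit into smooth coefficients, δ_Z gives rapid decay in p, and the functions ξ·Φ span a space
stable under partial derivatives. -/

theorem e_add (a b : ℝ) : e (a + b) = e a * e b := by
  unfold e; rw [← Complex.exp_add]; congr 1; push_cast; ring

theorem conj_e (a : ℝ) : conj (e a) = e (-a) := by
  unfold e; rw [← Complex.exp_conj]; congr 1; simp [Complex.conj_ofNat]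

theorem e_zero : e 0 = 1 := by simp [e]

theorem norm_e (a : ℝ) : ‖e a‖ = 1 := by
  unfold e; rw [Complex.norm_exp]; simp

theorem e_int (k : ℤ) : e k = 1 := by
  unfold e; rw [Complex.exp_eq_one_iff]; exact ⟨k, by push_cast; ring⟩

theorem e_add_int (a : ℝ) (k : ℤ) : e (a + k) = e a := by
  rw [e_add, e_int, mul_one]

theorem e_mul_e_neg (a : ℝ) : e a * e (-a) = 1 := by
  rw [← e_add, add_neg_cancel, e_zero]

theorem contDiff_e {n : WithTop ℕ∞} : ContDiff ℝ n e := by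
  unfold e
  exact Complex.contDiff_exp.comp (contDiff_const.mul Complex.ofRealCLM.contDiff)

theorem hasDerivAt_e (a : ℝ) : HasDerivAt e (2 * Real.pi * Complex.I * e a) a := by
  unfold e
  have h : HasDerivAt (fun t : ℝ => 2 * Real.pi * Complex.I * (t : ℂ))
      (2 * Real.pi * Complex.I) a := by
    simpa using (Complex.ofRealCLM.hasDerivAt (x := a)).const_mul (2 * Real.pi * Complex.I)
  convert h.cexp using 1; ring

/-! ### Partial derivatives -/

/-- The real linear form `a dx + b dy` on `ℝ × ℝ`. -/
def lin2 (a b : ℂ) : ℝ × ℝ →L[ℝ] ℂ :=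
  (ContinuousLinearMap.fst ℝ ℝ ℝ).smulRight a + (ContinuousLinearMap.snd ℝ ℝ ℝ).smulRight b

@[simp] theorem lin2_apply (a b : ℂ) (v : ℝ × ℝ) : lin2 a b v = v.1 * a + v.2 * b := by
  simp [lin2]

theorem norm_lin2_le (a b : ℂ) : ‖lin2 a b‖ ≤ ‖a‖ + ‖b‖ := by
  refine ContinuousLinearMap.opNorm_le_bound _ (by positivity) fun v => ?_
  rw [lin2_apply, add_mul]
  refine (norm_add_le _ _).trans (add_le_add ?_ ?_)
  · rw [norm_mul, mul_comm, Complex.norm_real]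
    exact mul_le_mul_of_nonneg_left (norm_fst_le v) (norm_nonneg _)
  · rw [norm_mul, mul_comm, Complex.norm_real]
    exact mul_le_mul_of_nonneg_left (norm_snd_le v) (norm_nonneg _)

theorem lin2_eq_smulRightL (a b : ℂ) : lin2 a b =
    ContinuousLinearMap.smulRightL ℝ (ℝ × ℝ) ℂ (ContinuousLinearMap.fst ℝ ℝ ℝ) a +
    ContinuousLinearMap.smulRightL ℝ (ℝ × ℝ) ℂ (ContinuousLinearMap.snd ℝ ℝ ℝ) b := rfl

/-- Differentiating a series termwise yields a sum of linear forms; this identifies it with the form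
of the summed partials. -/
theorem hasSum_lin2 {ι : Type*} {a b : ι → ℂ} {A B : ℂ} (ha : HasSum a A) (hb : HasSum b B) :
    HasSum (fun i => lin2 (a i) (b i)) (lin2 A B) := by
  simp only [lin2_eq_smulRightL]
  exact (ContinuousLinearMap.hasSum _ ha).add (ContinuousLinearMap.hasSum _ hb)

/-- `f` is differentiable with partial derivatives `f₁` and `f₂`. -/
def HasPartials (f f₁ f₂ : ℝ × ℝ → ℂ) : Prop := ∀ m, HasFDerivAt f (lin2 (f₁ m) (f₂ m)) m

/-- The partial derivative in the first variable. -/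
def pdx (f : ℝ × ℝ → ℂ) (m : ℝ × ℝ) : ℂ := deriv (fun x : ℝ => f (x, m.2)) m.1

/-- The partial derivative in the second variable. -/
def pdy (f : ℝ × ℝ → ℂ) (m : ℝ × ℝ) : ℂ := deriv (fun y : ℝ => f (m.1, y)) m.2

namespace HasPartials

variable {f g f₁ f₂ g₁ g₂ : ℝ × ℝ → ℂ}

theorem pdx_eq (h : HasPartials f f₁ f₂) : pdx f = f₁ := by
  funext m
  have h1 : HasDerivAt (fun x : ℝ => (x, m.2)) ((1, 0) : ℝ × ℝ) m.1 :=
    (hasDerivAt_id m.1).prodMk (hasDerivAt_const _ _)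
  have := ((h m).comp_hasDerivAt m.1 h1).deriv
  simpa [Function.comp_def, pdx, pdy] using this

theorem pdy_eq (h : HasPartials f f₁ f₂) : pdy f = f₂ := by
  funext m
  have h1 : HasDerivAt (fun y : ℝ => (m.1, y)) ((0, 1) : ℝ × ℝ) m.2 :=
    (hasDerivAt_const _ _).prodMk (hasDerivAt_id m.2)
  have := ((h m).comp_hasDerivAt m.2 h1).deriv
  simpa [Function.comp_def, pdx, pdy] using this

theorem continuous (h : HasPartials f f₁ f₂) : Continuous f :=
  continuous_iff_continuousAt.2 fun m => (h m).continuousAt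

theorem of_eq {f₁' f₂' : ℝ × ℝ → ℂ} (h : HasPartials f f₁ f₂) (h1 : ∀ m, f₁ m = f₁' m)
    (h2 : ∀ m, f₂ m = f₂' m) : HasPartials f f₁' f₂' := by
  intro m; rw [← h1, ← h2]; exact h m

theorem add (hf : HasPartials f f₁ f₂) (hg : HasPartials g g₁ g₂) :
    HasPartials (fun m => f m + g m) (fun m => f₁ m + g₁ m) (fun m => f₂ m + g₂ m) := by
  intro m
  refine ((hf m).add (hg m)).congr_fderiv ?_
  ext <;> simp

theorem mul (hf : HasPartials f f₁ f₂) (hg : HasPartials g g₁ g₂) :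
    HasPartials (fun m => f m * g m) (fun m => f₁ m * g m + f m * g₁ m)
      (fun m => f₂ m * g m + f m * g₂ m) := by
  intro m
  refine ((hf m).mul (hg m)).congr_fderiv ?_
  ext <;> simp <;> ring

theorem const_mul (a : ℂ) (hf : HasPartials f f₁ f₂) :
    HasPartials (fun m => a * f m) (fun m => a * f₁ m) (fun m => a * f₂ m) := by
  intro m
  refine ((hf m).const_mul a).congr_fderiv ?_
  ext <;> simp

theorem conjugate (hf : HasPartials f f₁ f₂) :
    HasPartials (fun m => conj (f m)) (fun m => conj (f₁ m)) (fun m => conj (f₂ m)) := by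
  intro m
  refine ((Complex.conjCLE.toContinuousLinearMap.hasFDerivAt).comp m (hf m)).congr_fderiv ?_
  ext <;> simp

theorem comp_add (hf : HasPartials f f₁ f₂) (a b : ℝ) :
    HasPartials (fun m => f (m.1 + a, m.2 + b)) (fun m => f₁ (m.1 + a, m.2 + b))
      (fun m => f₂ (m.1 + a, m.2 + b)) := by
  intro m
  exact (hasFDerivAt_comp_add_right (a, b)).2 (hf (m + (a, b)))

theorem coord : HasPartials (fun m => (m.1 : ℂ)) (fun _ => 1) (fun _ => 0) := by
  intro m
  refine ((Complex.ofRealCLM.comp (ContinuousLinearMap.fst ℝ ℝ ℝ)).hasFDerivAt).congr_fderiv ?_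
  ext <;> simp

theorem e_comp (a b : ℝ) : HasPartials (fun m => e (a * (m.2 - b))) (fun _ => 0)
    (fun m => 2 * Real.pi * Complex.I * a * e (a * (m.2 - b))) := by
  intro m
  have h : HasFDerivAt (fun m : ℝ × ℝ => a * (m.2 - b))
      (a • ContinuousLinearMap.snd ℝ ℝ ℝ) m :=
    ((ContinuousLinearMap.snd ℝ ℝ ℝ).hasFDerivAt.sub_const b).const_mul a
  refine ((hasDerivAt_e _).hasFDerivAt.comp m h).congr_fderiv ?_
  ext <;> simp <;> ring

theorem of_contDiff {f : ℝ × ℝ → ℂ} (hf : ContDiff ℝ ∞ f) : HasPartials f (pdx f) (pdy f) := by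
  have h : HasPartials f (fun m => fderiv ℝ f m (1, 0)) (fun m => fderiv ℝ f m (0, 1)) := by
    intro m
    refine ((hf.differentiable (by simp)) m).hasFDerivAt.congr_fderiv ?_
    ext <;> simp
  rw [h.pdx_eq, h.pdy_eq]; exact h

end HasPartials

theorem pdx_eq_fderiv {f : ℝ × ℝ → ℂ} (hf : ContDiff ℝ ∞ f) :
    pdx f = fun m => fderiv ℝ f m (1, 0) := by
  funext m; rw [(HasPartials.of_contDiff hf m).fderiv]; simp

theorem pdy_eq_fderiv {f : ℝ × ℝ → ℂ} (hf : ContDiff ℝ ∞ f) :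
    pdy f = fun m => fderiv ℝ f m (0, 1) := by
  funext m; rw [(HasPartials.of_contDiff hf m).fderiv]; simp

theorem contDiff_pdx {f : ℝ × ℝ → ℂ} (hf : ContDiff ℝ ∞ f) : ContDiff ℝ ∞ (pdx f) := by
  rw [pdx_eq_fderiv hf]; exact (hf.fderiv_right (by simp)).clm_apply contDiff_const

theorem contDiff_pdy {f : ℝ × ℝ → ℂ} (hf : ContDiff ℝ ∞ f) : ContDiff ℝ ∞ (pdy f) := by
  rw [pdy_eq_fderiv hf]; exact (hf.fderiv_right (by simp)).clm_apply contDiff_const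

theorem pdx_pdy_comm {f : ℝ × ℝ → ℂ} (hf : ContDiff ℝ ∞ f) : pdx (pdy f) = pdy (pdx f) := by
  rw [pdx_eq_fderiv (contDiff_pdy hf), pdy_eq_fderiv (contDiff_pdx hf), pdx_eq_fderiv hf,
    pdy_eq_fderiv hf]
  funext m
  have hd : DifferentiableAt ℝ (fderiv ℝ f) m :=
    ((hf.fderiv_right (m := ∞) (by simp)).differentiable (by simp)) m
  have hs : IsSymmSndFDerivAt ℝ f m := (contDiff_infty.1 hf 2).contDiffAt.isSymmSndFDerivAt
    (by simp)
  rw [fderiv_clm_apply hd (differentiableAt_const _), fderiv_clm_apply hd (differentiableAt_const _)]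
  simpa using hs (1, 0) (0, 1)

/-! ### The Schwartz space `Ξ^∞` -/

section Xi

/-- The total derivative of `f` is `L₁ ∘ f₁ + L₂ ∘ f₂` with fixed continuous linear `L₁`, `L₂`, so
only the partials need to be controlled. -/
theorem norm_iteratedFDeriv_succ_le {f f₁ f₂ : ℝ × ℝ → ℂ} {n : ℕ} (h : HasPartials f f₁ f₂)
    (h₁ : ContDiff ℝ n f₁) (h₂ : ContDiff ℝ n f₂) :
    ∃ A : ℝ, 0 ≤ A ∧ ∀ m, ‖iteratedFDeriv ℝ (n + 1) f m‖ ≤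
      A * (‖iteratedFDeriv ℝ n f₁ m‖ + ‖iteratedFDeriv ℝ n f₂ m‖) := by
  set L₁ := ContinuousLinearMap.smulRightL ℝ (ℝ × ℝ) ℂ (ContinuousLinearMap.fst ℝ ℝ ℝ)
  set L₂ := ContinuousLinearMap.smulRightL ℝ (ℝ × ℝ) ℂ (ContinuousLinearMap.snd ℝ ℝ ℝ)
  refine ⟨‖L₁‖ + ‖L₂‖, by positivity, fun m => ?_⟩
  have hfd : fderiv ℝ f = (L₁ ∘ f₁) + (L₂ ∘ f₂) := by
    funext m; rw [(h m).fderiv]; exact lin2_eq_smulRightL _ _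
  rw [← norm_iteratedFDeriv_fderiv, hfd,
    iteratedFDeriv_add (L₁.contDiff.comp h₁) (L₂.contDiff.comp h₂)]
  have e1 := L₁.norm_iteratedFDeriv_comp_left (x := m) h₁.contDiffAt le_rfl
  have e2 := L₂.norm_iteratedFDeriv_comp_left (x := m) h₂.contDiffAt le_rfl
  refine (norm_add_le _ _).trans ?_
  nlinarith [mul_nonneg (norm_nonneg L₁) (norm_nonneg (iteratedFDeriv ℝ n f₂ m)),
    mul_nonneg (norm_nonneg L₂) (norm_nonneg (iteratedFDeriv ℝ n f₁ m))]

/-- A class of rapidly decaying periodic functions which is closed under partial derivatives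
consists of Schwartz functions. -/
theorem mem_Xi_of_class (𝒞 : Set (ℝ × ℝ → ℂ))
    (hper : ∀ f ∈ 𝒞, ∀ x y, f (x, y + 1) = f (x, y))
    (hdecay : ∀ f ∈ 𝒞, ∀ k : ℕ, ∃ C : ℝ, ∀ m, |m.1| ^ k * ‖f m‖ ≤ C)
    (hpart : ∀ f ∈ 𝒞, ∃ f₁ ∈ 𝒞, ∃ f₂ ∈ 𝒞, HasPartials f f₁ f₂) {f : ℝ × ℝ → ℂ} (hf : f ∈ 𝒞) :
    f ∈ Xi := by
  -- The claim ranges over the whole class, so that the induction hypothesis applies to both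
  -- partials.
  have key : ∀ n : ℕ, ∀ f ∈ 𝒞, ContDiff ℝ n f ∧
      ∀ k : ℕ, ∃ C : ℝ, ∀ m : ℝ × ℝ, |m.1| ^ k * ‖iteratedFDeriv ℝ n f m‖ ≤ C := by
    intro n
    induction n with
    | zero =>
      intro f hf
      obtain ⟨f₁, -, f₂, -, h⟩ := hpart f hf
      refine ⟨contDiff_zero.2 h.continuous, fun k => ?_⟩
      simpa using hdecay f hf k
    | succ n ih =>
      intro f hf
      obtain ⟨f₁, h1, f₂, h2, h⟩ := hpart f hf
      obtain ⟨c1, b1⟩ := ih f₁ h1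
      obtain ⟨c2, b2⟩ := ih f₂ h2
      refine ⟨?_, fun k => ?_⟩
      · have := contDiff_succ_iff_hasFDerivAt (𝕜 := ℝ) (f := f) (n := n)
        push_cast
        refine this.2 ⟨_, ?_, h⟩
        simp only [lin2_eq_smulRightL]
        exact (ContinuousLinearMap.contDiff _ |>.comp c1).add
          (ContinuousLinearMap.contDiff _ |>.comp c2)
      · obtain ⟨A, hA, hb⟩ := norm_iteratedFDeriv_succ_le h c1 c2
        obtain ⟨C1, hC1⟩ := b1 k
        obtain ⟨C2, hC2⟩ := b2 k
        refine ⟨A * (C1 + C2), fun m => ?_⟩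
        calc |m.1| ^ k * ‖iteratedFDeriv ℝ (n + 1) f m‖
            ≤ |m.1| ^ k * (A * (‖iteratedFDeriv ℝ n f₁ m‖ + ‖iteratedFDeriv ℝ n f₂ m‖)) :=
              mul_le_mul_of_nonneg_left (hb m) (by positivity)
          _ = A * (|m.1| ^ k * ‖iteratedFDeriv ℝ n f₁ m‖ +
                |m.1| ^ k * ‖iteratedFDeriv ℝ n f₂ m‖) := by ring
          _ ≤ _ := mul_le_mul_of_nonneg_left (add_le_add (hC1 m) (hC2 m)) hA
  exact ⟨contDiff_infty.2 fun n => (key n f hf).1, hper f hf, fun k n => (key n f hf).2 k⟩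

variable {f g : ℝ × ℝ → ℂ}

theorem hasPartials_of_mem_Xi (hf : f ∈ Xi) : HasPartials f (pdx f) (pdy f) :=
  .of_contDiff hf.1

theorem add_mem_Xi (hf : f ∈ Xi) (hg : g ∈ Xi) : (fun m => f m + g m) ∈ Xi := by
  refine ⟨hf.1.add hg.1, fun x y => by simp only [hf.2.1, hg.2.1], fun k n => ?_⟩
  obtain ⟨C, hC⟩ := hf.2.2 k n
  obtain ⟨C', hC'⟩ := hg.2.2 k n
  refine ⟨C + C', fun m => ?_⟩
  have : iteratedFDeriv ℝ n (fun m => f m + g m) m =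
      iteratedFDeriv ℝ n f m + iteratedFDeriv ℝ n g m :=
    congrFun (iteratedFDeriv_add (hf.1.of_le (by exact_mod_cast le_top))
      (hg.1.of_le (by exact_mod_cast le_top))) m
  rw [this]
  calc _ ≤ |m.1| ^ k * (‖iteratedFDeriv ℝ n f m‖ + ‖iteratedFDeriv ℝ n g m‖) :=
        mul_le_mul_of_nonneg_left (norm_add_le _ _) (by positivity)
    _ ≤ _ := by rw [mul_add]; exact add_le_add (hC m) (hC' m)

theorem const_mul_mem_Xi (a : ℂ) (hf : f ∈ Xi) : (fun m => a * f m) ∈ Xi := by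
  refine ⟨contDiff_const.mul hf.1, fun x y => by simp only [hf.2.1], fun k n => ?_⟩
  obtain ⟨C, hC⟩ := hf.2.2 k n
  refine ⟨‖ContinuousLinearMap.mul ℝ ℂ a‖ * C, fun m => ?_⟩
  have h := (ContinuousLinearMap.mul ℝ ℂ a).norm_iteratedFDeriv_comp_left (x := m) (n := n)
    hf.1.contDiffAt (by exact_mod_cast le_top)
  refine (mul_le_mul_of_nonneg_left h (by positivity)).trans ?_
  rw [mul_left_comm]
  exact mul_le_mul_of_nonneg_left (hC m) (norm_nonneg _)

theorem neg_mem_Xi (hf : f ∈ Xi) : (fun m => -f m) ∈ Xi := by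
  simpa using const_mul_mem_Xi (-1) hf

theorem fderiv_apply_mem_Xi (v : ℝ × ℝ) (hf : f ∈ Xi) : (fun m => fderiv ℝ f m v) ∈ Xi := by
  refine ⟨(hf.1.fderiv_right (by simp)).clm_apply contDiff_const, fun x y => ?_, fun k n => ?_⟩
  · have h : (fun m : ℝ × ℝ => f (m + (0, 1))) = f := by
      funext m; exact (congrArg f (by simp [Prod.ext_iff])).trans (hf.2.1 m.1 m.2)
    have h2 := fderiv_comp_add_right (𝕜 := ℝ) (f := f) (x := (x, y)) ((0, 1) : ℝ × ℝ)
    rw [h] at h2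
    simp only [h2, Prod.mk_add_mk, add_zero]
  · obtain ⟨C, hC⟩ := hf.2.2 k (n + 1)
    refine ⟨‖v‖ * C, fun m => ?_⟩
    have h := norm_iteratedFDeriv_clm_apply_const (𝕜 := ℝ) (f := fderiv ℝ f) (c := v) (x := m)
      (n := n) ((hf.1.fderiv_right (m := ∞) (by simp)).contDiffAt) (by exact_mod_cast le_top)
    rw [norm_iteratedFDeriv_fderiv] at h
    calc _ ≤ |m.1| ^ k * (‖v‖ * ‖iteratedFDeriv ℝ (n + 1) f m‖) :=
          mul_le_mul_of_nonneg_left h (by positivity)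
      _ = ‖v‖ * (|m.1| ^ k * ‖iteratedFDeriv ℝ (n + 1) f m‖) := by ring
      _ ≤ _ := mul_le_mul_of_nonneg_left (hC m) (norm_nonneg _)

theorem pdx_mem_Xi (hf : f ∈ Xi) : pdx f ∈ Xi := by
  rw [pdx_eq_fderiv hf.1]; exact fderiv_apply_mem_Xi _ hf

theorem pdy_mem_Xi (hf : f ∈ Xi) : pdy f ∈ Xi := by
  rw [pdy_eq_fderiv hf.1]; exact fderiv_apply_mem_Xi _ hf

theorem decay_of_mem_Xi (hf : f ∈ Xi) (k : ℕ) : ∃ C : ℝ, ∀ m : ℝ × ℝ, |m.1| ^ k * ‖f m‖ ≤ C := by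
  simpa using hf.2.2 k 0

theorem coord_mul_mem_Xi (hf : f ∈ Xi) : (fun m => (m.1 : ℂ) * f m) ∈ Xi := by
  -- Since ∂_x(xf) = f + x∂_x f, products xf alone are not stable under ∂_x; sums xf + g are. The
  -- function itself is the case g = 0.
  refine mem_Xi_of_class {h | ∃ f ∈ Xi, ∃ g ∈ Xi, h = fun m => (m.1 : ℂ) * f m + g m} ?_ ?_ ?_
    ⟨f, hf, fun m => 0 * f m, const_mul_mem_Xi 0 hf, by simp⟩
  · rintro _ ⟨f, hf, g, hg, rfl⟩ x y
    simp only [hf.2.1, hg.2.1]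
  · rintro _ ⟨f, hf, g, hg, rfl⟩ k
    obtain ⟨C, hC⟩ := decay_of_mem_Xi hf (k + 1)
    obtain ⟨C', hC'⟩ := decay_of_mem_Xi hg k
    refine ⟨C + C', fun m => ?_⟩
    calc _ ≤ |m.1| ^ k * (|m.1| * ‖f m‖ + ‖g m‖) := by
          refine mul_le_mul_of_nonneg_left ((norm_add_le _ _).trans ?_) (by positivity)
          simp
      _ = |m.1| ^ (k + 1) * ‖f m‖ + |m.1| ^ k * ‖g m‖ := by ring
      _ ≤ _ := add_le_add (hC m) (hC' m)
  · rintro _ ⟨f, hf, g, hg, rfl⟩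
    refine ⟨_, ⟨pdx f, pdx_mem_Xi hf, _, add_mem_Xi hf (pdx_mem_Xi hg), rfl⟩, _,
      ⟨pdy f, pdy_mem_Xi hf, _, pdy_mem_Xi hg, rfl⟩, ?_⟩
    refine ((HasPartials.coord.mul (hasPartials_of_mem_Xi hf)).add
      (hasPartials_of_mem_Xi hg)).of_eq ?_ ?_ <;> intro m <;> simp <;> ring

/-- Rapid decay with the weights `(1 + |x|)^k`. -/
theorem decay_one_add_of_mem_Xi (k : ℕ) : ∀ {f}, f ∈ Xi →
    ∃ C : ℝ, ∀ m : ℝ × ℝ, (1 + |m.1|) ^ k * ‖f m‖ ≤ C := by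
  induction k with
  | zero => intro f hf; simpa using decay_of_mem_Xi hf 0
  | succ k ih =>
    intro f hf
    obtain ⟨C, hC⟩ := ih hf
    obtain ⟨C', hC'⟩ := ih (coord_mul_mem_Xi hf)
    refine ⟨C + C', fun m => ?_⟩
    have h1 := hC m
    have h2 := hC' m
    rw [norm_mul, Complex.norm_real, Real.norm_eq_abs] at h2
    calc _ = (1 + |m.1|) ^ k * ‖f m‖ + (1 + |m.1|) ^ k * (|m.1| * ‖f m‖) := by ring
      _ ≤ _ := add_le_add h1 h2

theorem nablaZero_eq (c : ℕ) (μ : ℝ) (V : heis) (f : ℝ × ℝ → ℂ) : nablaZero c μ V f = fun m =>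
    coordX V * (-pdy f m + Real.pi * c * Complex.I / (2 * μ) * m.1 ^ 2 * f m)
    + coordY V * (-pdx f m) + coordZ c V * (Real.pi * Complex.I * m.1 / μ * f m) := rfl

theorem nablaZero_mem_Xi (c : ℕ) (μ : ℝ) (V : heis) (hf : f ∈ Xi) : nablaZero c μ V f ∈ Xi := by
  have hx := coord_mul_mem_Xi hf
  have h := add_mem_Xi (add_mem_Xi (const_mul_mem_Xi (coordX V) (add_mem_Xi
    (neg_mem_Xi (pdy_mem_Xi hf)) (const_mul_mem_Xi (Real.pi * c * Complex.I / (2 * μ))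
      (coord_mul_mem_Xi hx)))) (const_mul_mem_Xi (coordY V) (neg_mem_Xi (pdx_mem_Xi hf))))
      (const_mul_mem_Xi (coordZ c V * (Real.pi * Complex.I / μ)) hx)
  convert h using 1
  rw [nablaZero_eq]; funext m; ring

end Xi

/-! ### Summable weights -/

/-- The weight `(1 + |t|)⁻²`. -/
def bw (t : ℝ) : ℝ := ((1 + |t|) ^ 2)⁻¹

theorem bw_pos (t : ℝ) : 0 < bw t := by unfold bw; positivity

theorem bw_nonneg (t : ℝ) : 0 ≤ bw t := (bw_pos t).le

theorem bw_le_one (t : ℝ) : bw t ≤ 1 := by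
  unfold bw
  exact inv_le_one_of_one_le₀ (one_le_pow₀ (by linarith [abs_nonneg t]))

/-- Peetre-type inequality: a translation by `s` costs at most a factor 1 + |s| in the weight. -/
theorem one_add_abs_le (s t : ℝ) : 1 + |t| ≤ (1 + |t + s|) * (1 + |s|) := by
  have h : |t| ≤ |t + s| + |s| := by
    calc |t| = |t + s - s| := by ring_nf
      _ ≤ _ := abs_sub _ _
  nlinarith [abs_nonneg (t + s), abs_nonneg s, mul_nonneg (abs_nonneg (t + s)) (abs_nonneg s)]

theorem bw_add_le (s t : ℝ) : bw (t + s) ≤ (1 + |s|) ^ 2 * bw t := by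
  unfold bw
  rw [← div_eq_mul_inv, inv_eq_one_div, div_le_div_iff₀ (by positivity) (by positivity), one_mul,
    mul_comm, ← mul_pow]
  exact pow_le_pow_left₀ (by positivity) (one_add_abs_le s t) 2

theorem summable_bw : Summable fun k : ℤ => bw k := by
  have h : Summable fun k : ℤ => |1 / (k : ℝ) ^ 2| :=
    (Real.summable_one_div_int_pow.2 one_lt_two).abs
  refine Summable.of_norm_bounded_eventually (g := fun k : ℤ => |1 / (k : ℝ) ^ 2|) h ?_
  filter_upwards [(Set.finite_singleton (0 : ℤ)).compl_mem_cofinite] with k hk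
  have hk' : 0 < |(k : ℝ)| := abs_pos.2 (by exact_mod_cast hk)
  rw [Real.norm_of_nonneg (bw_nonneg _), abs_of_nonneg (by positivity), ← sq_abs (k : ℝ), bw,
    one_div]
  exact inv_anti₀ (by positivity) (pow_le_pow_left₀ hk'.le (by linarith) 2)

theorem summable_bw_add (x : ℝ) : Summable fun k : ℤ => bw (x + k) := by
  refine Summable.of_nonneg_of_le (fun k => bw_nonneg _) (fun k => ?_)
    (summable_bw.mul_left ((1 + |x|) ^ 2))
  rw [add_comm]; exact bw_add_le x k

/-- The total weight of `ℤ`, up to a factor which makes it a bound for all translates. -/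
def bwSum : ℝ := 4 * ∑' k : ℤ, bw k

theorem bwSum_nonneg : 0 ≤ bwSum := mul_nonneg (by norm_num) (tsum_nonneg fun _ => bw_nonneg _)

/-- The sum over ℤ depends only on the fractional part of `x`, which lies in [0, 1), so the
translation costs at most (1 + 1)² = 4. -/
theorem tsum_bw_add_le (x : ℝ) : ∑' k : ℤ, bw (x + k) ≤ bwSum := by
  have h1 : ∑' k : ℤ, bw (x + k) = ∑' k : ℤ, bw (Int.fract x + k) := by
    rw [← (Equiv.addLeft ⌊x⌋).tsum_eq (fun k : ℤ => bw (Int.fract x + k))]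
    refine tsum_congr fun k => ?_
    congr 1
    simp only [Equiv.coe_addLeft, Int.cast_add, ← add_assoc, Int.fract_add_floor]
  rw [h1, bwSum, ← tsum_mul_left]
  refine (summable_bw_add _).tsum_le_tsum (fun k => ?_) (summable_bw.mul_left 4)
  have h2 := bw_add_le (Int.fract x) k
  rw [add_comm] at h2
  refine h2.trans (mul_le_mul_of_nonneg_right ?_ (bw_nonneg _))
  rw [abs_of_nonneg (Int.fract_nonneg x)]
  nlinarith [Int.fract_nonneg x, Int.fract_lt_one x]

/-! ### Matrix entries of operators -/

section Represents

variable {μ ν : ℝ}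

/-- The matrix entry of an operator at `(i, j)`. -/
def entry (i j : (ℝ × ℝ) × ℤ) : (Hilb →L[ℂ] Hilb) →L[ℂ] ℂ :=
  (lp.evalCLM ℂ (fun _ : (ℝ × ℝ) × ℤ => ℂ) 2 i).comp
    (ContinuousLinearMap.apply ℂ Hilb (lp.single 2 j (1 : ℂ)))

theorem entry_apply (i j : (ℝ × ℝ) × ℤ) (T : Hilb →L[ℂ] Hilb) :
    entry i j T = T (lp.single 2 j (1 : ℂ)) i := rfl

theorem norm_entry_le (i j : (ℝ × ℝ) × ℤ) (T : Hilb →L[ℂ] Hilb) : ‖entry i j T‖ ≤ ‖T‖ := by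
  rw [entry_apply]
  refine (lp.norm_apply_le_norm two_ne_zero _ i).trans ?_
  refine (T.le_opNorm _).trans ?_
  rw [lp.norm_single (by norm_num)]; simp

theorem flow_zero (m : ℝ × ℝ) : flow μ ν 0 m = m := by simp [flow]

theorem flow_flow (p q : ℤ) (m : ℝ × ℝ) : flow μ ν p (flow μ ν q m) = flow μ ν (q + p) m := by
  simp only [flow, Prod.mk.injEq]; push_cast; constructor <;> ring

theorem Represents.entry_eq {T : Hilb →L[ℂ] Hilb} {Φ : ℝ × ℝ → ℤ → ℂ} (h : Represents μ ν T Φ)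
    (m m' : ℝ × ℝ) (n n' : ℤ) :
    entry (m, n) (m', n') T = if m' = m then Φ (flow μ ν n m) (n - n') else 0 := by
  rw [entry_apply]
  refine (h (lp.single 2 (m', n') (1 : ℂ)) m n).unique ?_
  have := hasSum_single (f := fun q : ℤ => Φ (flow μ ν n m) q *
    lp.single (E := fun _ : (ℝ × ℝ) × ℤ => ℂ) 2 (m', n') (1 : ℂ) (m, n - q)) (n - n') (by
      intro q hq
      rw [lp.single_apply_ne, mul_zero]
      intro h; apply hq
      have := congrArg Prod.snd h
      simp only at this; omega)
  convert this using 1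
  split_ifs with hm
  · subst hm; simp
  · rw [lp.single_apply_ne, mul_zero]
    intro h; exact hm (congrArg Prod.fst h).symm

/-- A vector of ℓ² is the norm-convergent sum of its components. Applying the continuous functional
ξ ↦ (Tξ)(m, n) leaves only the terms over the base point `m`. Representation thus becomes a
condition on entries, which are continuous and linear in the operator. -/
theorem represents_of_entry {T : Hilb →L[ℂ] Hilb} {Φ : ℝ × ℝ → ℤ → ℂ}
    (h : ∀ m m' n n', entry (m, n) (m', n') T = if m' = m then Φ (flow μ ν n m) (n - n') else 0) :
    Represents μ ν T Φ := by
  intro ξ m n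
  have h1 := ((lp.evalCLM ℂ (fun _ : (ℝ × ℝ) × ℤ => ℂ) 2 (m, n)).comp T).hasSum
    (lp.hasSum_single (by norm_num) ξ)
  have h2 : ∀ i : (ℝ × ℝ) × ℤ, ((lp.evalCLM ℂ (fun _ : (ℝ × ℝ) × ℤ => ℂ) 2 (m, n)).comp T)
      (lp.single 2 i (ξ i)) = ξ i * if i.1 = m then Φ (flow μ ν n m) (n - i.2) else 0 := by
    intro i
    have : lp.single (E := fun _ : (ℝ × ℝ) × ℤ => ℂ) 2 i (ξ i) =
        ξ i • lp.single (E := fun _ : (ℝ × ℝ) × ℤ => ℂ) 2 i (1 : ℂ) := by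
      rw [← lp.single_smul, smul_eq_mul, mul_one]
    rw [this, map_smul, smul_eq_mul, ← h m i.1 n i.2]; rfl
  simp only [h2] at h1
  have hinj : Function.Injective (fun q : ℤ => (m, n - q)) := by
    intro a b hab
    have := congrArg Prod.snd hab
    simp only at this; omega
  rw [← hinj.hasSum_iff] at h1
  · have h3 : ((fun b : (ℝ × ℝ) × ℤ => ξ b * if b.1 = m then Φ (flow μ ν n m) (n - b.2) else 0) ∘
        fun q : ℤ => (m, n - q)) = fun q => Φ (flow μ ν n m) q * ξ (m, n - q) := by
      funext q; simp [mul_comm]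
    rw [h3] at h1
    exact h1
  · rintro ⟨m', n'⟩ hi
    have : m' ≠ m := by
      rintro rfl; exact hi ⟨n - n', by simp⟩
    simp [this]

/-- Row 0 is used because the flow is trivial there. -/
theorem Represents.coeff {T : Hilb →L[ℂ] Hilb} {Φ : ℝ × ℝ → ℤ → ℂ} (h : Represents μ ν T Φ)
    (m : ℝ × ℝ) (p : ℤ) : entry (m, 0) (m, -p) T = Φ m p := by
  rw [h.entry_eq]; simp [flow_zero]

theorem Represents.norm_le {T : Hilb →L[ℂ] Hilb} {Φ : ℝ × ℝ → ℤ → ℂ} (h : Represents μ ν T Φ)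
    (m : ℝ × ℝ) (p : ℤ) : ‖Φ m p‖ ≤ ‖T‖ := by
  rw [← h.coeff]; exact norm_entry_le _ _ _

theorem Represents.add {T S : Hilb →L[ℂ] Hilb} {Φ Ψ : ℝ × ℝ → ℤ → ℂ} (h : Represents μ ν T Φ)
    (h' : Represents μ ν S Ψ) : Represents μ ν (T + S) (Φ + Ψ) := by
  refine represents_of_entry fun m m' n n' => ?_
  rw [map_add, h.entry_eq, h'.entry_eq]
  split_ifs <;> simp

theorem Represents.smul {T : Hilb →L[ℂ] Hilb} {Φ : ℝ × ℝ → ℤ → ℂ} (a : ℂ)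
    (h : Represents μ ν T Φ) : Represents μ ν (a • T) (a • Φ) := by
  refine represents_of_entry fun m m' n n' => ?_
  rw [map_smul, h.entry_eq]
  split_ifs <;> simp

end Represents

/-! ### The derivative of the group action -/

/-- The real linear map `(r, s, t) ↦ r a + s b + t d` on `ℝ³`. -/
def lin3 {F : Type*} [NormedAddCommGroup F] [NormedSpace ℝ F] (a b d : F) : ℝ × ℝ × ℝ →L[ℝ] F :=
  (ContinuousLinearMap.fst ℝ ℝ (ℝ × ℝ)).smulRight a +
  ((ContinuousLinearMap.fst ℝ ℝ ℝ).comp (ContinuousLinearMap.snd ℝ ℝ (ℝ × ℝ))).smulRight b +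
  ((ContinuousLinearMap.snd ℝ ℝ ℝ).comp (ContinuousLinearMap.snd ℝ ℝ (ℝ × ℝ))).smulRight d

@[simp] theorem lin3_apply {F : Type*} [NormedAddCommGroup F] [NormedSpace ℝ F] (a b d : F)
    (v : ℝ × ℝ × ℝ) : lin3 a b d v = v.1 • a + v.2.1 • b + v.2.2 • d := by
  simp [lin3]

/-- Multiplication of coefficients by the grading, `(pΦ)(m, p) = p Φ(m, p)`. -/
def numP (Φ : ℝ × ℝ → ℤ → ℂ) : ℝ × ℝ → ℤ → ℂ := fun m p => p * Φ m p

/-- The coefficientwise derivative in the first variable. -/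
def famPdx (Φ : ℝ × ℝ → ℤ → ℂ) : ℝ × ℝ → ℤ → ℂ := fun m p => pdx (fun m => Φ m p) m

/-- The derivation `δ_X`. -/
def famX (c : ℕ) (μ : ℝ) (Φ : ℝ × ℝ → ℤ → ℂ) : ℝ × ℝ → ℤ → ℂ := fun m p =>
  2 * Real.pi * Complex.I * c * p * (m.1 - p * μ) * Φ m p - pdy (fun m => Φ m p) m

variable {c : ℕ} {μ ν : ℝ}

theorem delta_eq (V : heis) (Φ : ℝ × ℝ → ℤ → ℂ) : delta c μ V Φ =
    coordX V • famX c μ Φ + (-coordY V) • famPdx Φ +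
      (coordZ c V * (2 * Real.pi * Complex.I)) • numP Φ := by
  funext m p
  simp only [delta, famX, famPdx, numP, pdx, pdy, Pi.add_apply, Pi.smul_apply, smul_eq_mul]
  ring

theorem groupAct_zero (Φ : ℝ × ℝ → ℤ → ℂ) : groupAct c μ (0, 0, 0) Φ = Φ := by
  funext m p; simp [groupAct, e_zero]

theorem groupAct_add (h : ℝ × ℝ × ℝ) (Φ Ψ : ℝ × ℝ → ℤ → ℂ) :
    groupAct c μ h (Φ + Ψ) = groupAct c μ h Φ + groupAct c μ h Ψ := by
  funext m p; simp only [groupAct, Pi.add_apply]; ring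

theorem groupAct_smul (h : ℝ × ℝ × ℝ) (a : ℂ) (Φ : ℝ × ℝ → ℤ → ℂ) :
    groupAct c μ h (a • Φ) = a • groupAct c μ h Φ := by
  funext m p; simp only [groupAct, Pi.smul_apply, smul_eq_mul]; ring

/-- Derivatives of an orbit are orbits of the derivations. The group is not commutative: the phase
e(p(t + cs(x - r - pμ))) also depends on r, which adds a multiple of cs times the t-derivative to
the r-direction. -/
theorem hasFDerivAt_groupAct {Φ : ℝ × ℝ → ℤ → ℂ} {p : ℤ}
    (hΦ : HasPartials (fun m => Φ m p) (pdx fun m => Φ m p) (pdy fun m => Φ m p))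
    (m : ℝ × ℝ) (h : ℝ × ℝ × ℝ) :
    HasFDerivAt (fun h => groupAct c μ h Φ m p)
      (lin3 (-groupAct c μ h (famPdx Φ) m p
          - c * h.2.1 * (2 * Real.pi * Complex.I * groupAct c μ h (numP Φ) m p))
        (groupAct c μ h (famX c μ Φ) m p)
        (2 * Real.pi * Complex.I * groupAct c μ h (numP Φ) m p)) h := by
  have hr : HasFDerivAt (fun h : ℝ × ℝ × ℝ => h.1) (ContinuousLinearMap.fst ℝ ℝ (ℝ × ℝ)) h :=
    hasFDerivAt_fst
  have hs : HasFDerivAt (fun h : ℝ × ℝ × ℝ => h.2.1)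
      ((ContinuousLinearMap.fst ℝ ℝ ℝ).comp (ContinuousLinearMap.snd ℝ ℝ (ℝ × ℝ))) h :=
    hasFDerivAt_fst.comp h hasFDerivAt_snd
  have ht : HasFDerivAt (fun h : ℝ × ℝ × ℝ => h.2.2)
      ((ContinuousLinearMap.snd ℝ ℝ ℝ).comp (ContinuousLinearMap.snd ℝ ℝ (ℝ × ℝ))) h :=
    hasFDerivAt_snd.comp h hasFDerivAt_snd
  have ha := (ht.add ((hs.const_mul (c : ℝ)).mul
    ((hr.const_sub m.1).sub_const (p * μ)))).const_mul (p : ℝ)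
  have hf := (hΦ (m.1 - h.1, m.2 - h.2.1)).comp h ((hr.const_sub m.1).prodMk (hs.const_sub m.2))
  refine (((hasDerivAt_e _).hasFDerivAt.comp h ha).mul hf).congr_fderiv ?_
  ext <;> simp [groupAct, famPdx, famX, numP] <;> ring

/-! ### Smooth vectors -/

/-- Periodicity in `y` and covariance under integer translations in `x`. -/
def Covariant (c : ℕ) (ν : ℝ) (Φ : ℝ × ℝ → ℤ → ℂ) : Prop :=
  (∀ x y p, Φ (x, y + 1) p = Φ (x, y) p) ∧
    ∀ (k : ℤ) (x y : ℝ) (p : ℤ), Φ (x + k, y) p = e (c * k * p * (y - p * ν)) * Φ (x, y) p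

theorem covariant_iff_conj {Φ : ℂ} {Ψ : ℂ} (a : ℝ) : conj (e a) * Φ = Ψ ↔ Φ = e a * Ψ := by
  rw [conj_e]
  constructor
  · rintro rfl; rw [← mul_assoc, e_mul_e_neg, one_mul]
  · rintro rfl; rw [← mul_assoc, mul_comm (e (-a)), e_mul_e_neg, one_mul]

/-- Both conditions are closed linear relations between matrix entries, so they survive the norm
closure. -/
theorem covariant_of_mem_D {Φ : ℝ × ℝ → ℤ → ℂ} (hΦ : Φ ∈ D c μ ν) : Covariant c ν Φ := by
  obtain ⟨T, hT, hcl⟩ := hΦ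
  refine ⟨fun x y p => ?_, fun k x y p => ?_⟩
  · rw [← hT.coeff, ← hT.coeff]
    refine closure_minimal (t := {T | entry ((x, y + 1), 0) ((x, y + 1), -p) T =
      entry ((x, y), 0) ((x, y), -p) T}) ?_
      (isClosed_eq (ContinuousLinearMap.continuous _) (ContinuousLinearMap.continuous _)) hcl
    rintro S ⟨Ψ, hΨ, hS⟩
    rw [Set.mem_ofPred_eq, hS.coeff, hS.coeff]
    exact hΨ.2.1 x y p
  · rw [← hT.coeff, ← hT.coeff]
    refine closure_minimal (t := {T | entry ((x + k, y), 0) ((x + k, y), -p) T =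
      e (c * k * p * (y - p * ν)) * entry ((x, y), 0) ((x, y), -p) T}) ?_
      (isClosed_eq (ContinuousLinearMap.continuous _)
        ((ContinuousLinearMap.continuous _).const_mul _)) hcl
    rintro S ⟨Ψ, hΨ, hS⟩
    rw [Set.mem_ofPred_eq, hS.coeff, hS.coeff]
    exact (covariant_iff_conj _).1 (hΨ.2.2.2 k x y p)

/-- The covariant families whose orbit under the group action is represented by a smooth family
of operators. -/
def SmoothVec (c : ℕ) (μ ν : ℝ) : Set (ℝ × ℝ → ℤ → ℂ) :=
  {Φ | Covariant c ν Φ ∧ ∃ T : ℝ × ℝ × ℝ → (Hilb →L[ℂ] Hilb),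
    (∀ h, Represents μ ν (T h) (groupAct c μ h Φ)) ∧ ContDiff ℝ ∞ T}

variable {Φ Ψ : ℝ × ℝ → ℤ → ℂ}

/-- Covariance is all that is needed from membership in D. Dropping the closure condition makes
stability under the derivations direct. -/
theorem mem_SmoothVec_of_mem_DSmooth (h : Φ ∈ DSmooth c μ ν) : Φ ∈ SmoothVec c μ ν :=
  ⟨covariant_of_mem_D h.1, h.2⟩

theorem add_mem_SmoothVec (hΦ : Φ ∈ SmoothVec c μ ν) (hΨ : Ψ ∈ SmoothVec c μ ν) :
    Φ + Ψ ∈ SmoothVec c μ ν := by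
  obtain ⟨h1, T, hT, hs⟩ := hΦ
  obtain ⟨h1', T', hT', hs'⟩ := hΨ
  refine ⟨⟨fun x y p => ?_, fun k x y p => ?_⟩, fun h => T h + T' h, fun h => ?_, hs.add hs'⟩
  · simp only [Pi.add_apply, h1.1, h1'.1]
  · simp only [Pi.add_apply, h1.2, h1'.2]; ring
  · rw [groupAct_add]; exact (hT h).add (hT' h)

theorem smul_mem_SmoothVec (a : ℂ) (hΦ : Φ ∈ SmoothVec c μ ν) : a • Φ ∈ SmoothVec c μ ν := by
  obtain ⟨h1, T, hT, hs⟩ := hΦ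
  refine ⟨⟨fun x y p => ?_, fun k x y p => ?_⟩, fun h => a • T h, fun h => ?_, hs.const_smul a⟩
  · simp only [Pi.smul_apply, h1.1]
  · simp only [Pi.smul_apply, h1.2, smul_eq_mul]; ring
  · rw [groupAct_smul]; exact (hT h).smul a

theorem exists_bound_of_mem_SmoothVec (hΦ : Φ ∈ SmoothVec c μ ν) :
    ∃ C : ℝ, ∀ m p, ‖Φ m p‖ ≤ C := by
  obtain ⟨-, T, hT, -⟩ := hΦ
  refine ⟨‖T (0, 0, 0)‖, fun m p => ?_⟩
  have := (hT (0, 0, 0)).norm_le m p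
  rwa [groupAct_zero] at this

/-- Acting by (-x, -y, 0) moves the point (x, y) to the origin. Up to a smooth phase, Φ(x, y, p) is
therefore one fixed entry of the smooth operator family. -/
theorem contDiff_of_mem_SmoothVec (hΦ : Φ ∈ SmoothVec c μ ν) (p : ℤ) :
    ContDiff ℝ ∞ fun m => Φ m p := by
  obtain ⟨-, T, hT, hs⟩ := hΦ
  have h : (fun m => Φ m p) = fun m : ℝ × ℝ => e (p * (c * m.2 * (m.1 - p * μ))) *
      ((entry ((0, 0), 0) ((0, 0), -p)).restrictScalars ℝ) (T (-m.1, -m.2, 0)) := by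
    funext m
    simp only [ContinuousLinearMap.coe_restrictScalars', (hT _).coeff, groupAct]
    rw [← mul_assoc, ← e_add]
    have : (p : ℝ) * (c * m.2 * (m.1 - p * μ)) + p * (0 + c * -m.2 * (0 - -m.1 - p * μ)) = 0 := by
      ring
    rw [this, e_zero]; simp
  rw [h]
  refine (contDiff_e.comp (by fun_prop)).mul ?_
  exact (ContinuousLinearMap.contDiff _).comp (hs.comp (by fun_prop))

theorem hasPartials_of_mem_SmoothVec (hΦ : Φ ∈ SmoothVec c μ ν) (p : ℤ) :
    HasPartials (fun m => Φ m p) (pdx fun m => Φ m p) (pdy fun m => Φ m p) :=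
  .of_contDiff (contDiff_of_mem_SmoothVec hΦ p)

/-- Entries are continuous linear functionals, so they commute with the derivative of `T`;
coefficientwise derivatives are thus represented by bounded operators. -/
theorem represents_fderiv {T : ℝ × ℝ × ℝ → (Hilb →L[ℂ] Hilb)}
    (hT : ∀ h, Represents μ ν (T h) (groupAct c μ h Φ)) (hs : ContDiff ℝ ∞ T)
    (h v : ℝ × ℝ × ℝ) (hv : ∀ m p, ∃ L : ℝ × ℝ × ℝ →L[ℝ] ℂ,
      HasFDerivAt (fun h => groupAct c μ h Φ m p) L h ∧ L v = Ψ m p) :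
    Represents μ ν (fderiv ℝ T h v) Ψ := by
  refine represents_of_entry fun m m' n n' => ?_
  have h1 := (((entry (m, n) (m', n')).restrictScalars ℝ).hasFDerivAt.comp h
    ((hs.differentiable (by simp)) h).hasFDerivAt)
  have h2 : (((entry (m, n) (m', n')).restrictScalars ℝ) ∘ T) = fun h =>
      if m' = m then groupAct c μ h Φ (flow μ ν n m) (n - n') else 0 := by
    funext h; exact (hT h).entry_eq m m' n n'
  rw [h2] at h1
  obtain ⟨L, hL, hLv⟩ := hv (flow μ ν n m) (n - n')
  split_ifs at h1 ⊢ with hm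
  · rw [← hLv, ← h1.unique hL]; rfl
  · have := h1.unique (hasFDerivAt_const (0 : ℂ) h)
    exact congrArg (fun L => L v) this

theorem numP_mem_SmoothVec (hΦ : Φ ∈ SmoothVec c μ ν) : numP Φ ∈ SmoothVec c μ ν := by
  have hp := hasPartials_of_mem_SmoothVec hΦ
  obtain ⟨h1, T, hT, hs⟩ := hΦ
  have hpi : (2 * Real.pi * Complex.I : ℂ) ≠ 0 := Complex.two_pi_I_ne_zero
  refine ⟨⟨fun x y p => by simp only [numP, h1.1], fun k x y p => ?_⟩,
    fun h => (2 * Real.pi * Complex.I : ℂ)⁻¹ • fderiv ℝ T h (0, 0, 1), fun h => ?_, ?_⟩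
  · simp only [numP, h1.2]; ring
  · have := (represents_fderiv (Ψ := (2 * Real.pi * Complex.I : ℂ) • groupAct c μ h (numP Φ))
      hT hs h (0, 0, 1) fun m p => ⟨_, hasFDerivAt_groupAct (hp p) m h, by simp⟩).smul
      (2 * Real.pi * Complex.I : ℂ)⁻¹
    rwa [smul_smul, inv_mul_cancel₀ hpi, one_smul] at this
  · exact ((hs.fderiv_right (by simp)).clm_apply contDiff_const).const_smul _

theorem famX_mem_SmoothVec (hΦ : Φ ∈ SmoothVec c μ ν) : famX c μ Φ ∈ SmoothVec c μ ν := by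
  have hp := hasPartials_of_mem_SmoothVec hΦ
  obtain ⟨h1, T, hT, hs⟩ := hΦ
  refine ⟨⟨fun x y p => ?_, fun k x y p => ?_⟩, fun h => fderiv ℝ T h (0, 1, 0), fun h => ?_, ?_⟩
  · have h2 := (hp p).comp_add 0 1
    have h3 : (fun m : ℝ × ℝ => Φ (m.1 + 0, m.2 + 1) p) = fun m => Φ m p := by
      funext m; rw [add_zero]; exact h1.1 _ _ _
    rw [h3] at h2
    have h4 := congrFun h2.pdy_eq (x, y)
    simp only [add_zero] at h4
    simp only [famX, h1.1, h4]
  -- The term 2πickp from differentiating the phase in y cancels the change of 2πicp(x - pμ) under x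
  -- ↦ x + k.
  · have h2 := (hp p).comp_add k 0
    have h3 : (fun m : ℝ × ℝ => Φ (m.1 + k, m.2 + 0) p) =
        fun m => e (c * k * p * (m.2 - p * ν)) * Φ m p := by
      funext m; rw [add_zero]; exact h1.2 _ _ _ _
    rw [h3] at h2
    have h4 := congrFun (h2.pdy_eq.symm.trans
      ((HasPartials.e_comp (c * k * p) (p * ν)).mul (hp p)).pdy_eq) (x, y)
    simp only [add_zero] at h4
    simp only [famX, h1.2, h4]
    push_cast; ring
  · exact represents_fderiv hT hs h (0, 1, 0) fun m p =>
      ⟨_, hasFDerivAt_groupAct (hp p) m h, by simp⟩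
  · exact (hs.fderiv_right (by simp)).clm_apply contDiff_const

theorem famPdx_mem_SmoothVec (hΦ : Φ ∈ SmoothVec c μ ν) : famPdx Φ ∈ SmoothVec c μ ν := by
  have hp := hasPartials_of_mem_SmoothVec hΦ
  obtain ⟨h1, T, hT, hs⟩ := hΦ
  refine ⟨⟨fun x y p => ?_, fun k x y p => ?_⟩, fun h => fderiv ℝ T h (-1, 0, 0) +
    (-(c * h.2.1)) • fderiv ℝ T h (0, 0, 1), fun h => ?_, ?_⟩
  · have h2 := (hp p).comp_add 0 1
    have h3 : (fun m : ℝ × ℝ => Φ (m.1 + 0, m.2 + 1) p) = fun m => Φ m p := by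
      funext m; rw [add_zero]; exact h1.1 _ _ _
    rw [h3] at h2
    have h4 := congrFun h2.pdx_eq (x, y)
    simp only [add_zero] at h4
    simp only [famPdx, h4]
  · have h2 := (hp p).comp_add k 0
    have h3 : (fun m : ℝ × ℝ => Φ (m.1 + k, m.2 + 0) p) =
        fun m => e (c * k * p * (m.2 - p * ν)) * Φ m p := by
      funext m; rw [add_zero]; exact h1.2 _ _ _ _
    rw [h3] at h2
    have h4 := congrFun (h2.pdx_eq.symm.trans
      ((HasPartials.e_comp (c * k * p) (p * ν)).mul (hp p)).pdx_eq) (x, y)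
    simp only [add_zero] at h4
    simp only [famPdx, h4]
    ring
  -- The direction (-1, 0, -cs) varies with `h` and cancels the extra t-derivative in the
  -- r-direction; splitting it by linearity shows smoothness in `h`.
  · have := represents_fderiv (Ψ := groupAct c μ h (famPdx Φ)) hT hs h
      (-1, 0, -(c * h.2.1)) fun m p => ⟨_, hasFDerivAt_groupAct (hp p) m h, by simp⟩
    convert this using 1
    simp only [← map_smul, ← map_add]; simp
  · have hd : ContDiff ℝ ∞ (fderiv ℝ T) := hs.fderiv_right (by simp)
    refine (hd.clm_apply contDiff_const).add (ContDiff.fun_smul ?_ (hd.clm_apply contDiff_const))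
    fun_prop

theorem delta_mem_SmoothVec (V : heis) (hΦ : Φ ∈ SmoothVec c μ ν) :
    delta c μ V Φ ∈ SmoothVec c μ ν := by
  rw [delta_eq]
  exact add_mem_SmoothVec (add_mem_SmoothVec (smul_mem_SmoothVec _ (famX_mem_SmoothVec hΦ))
    (smul_mem_SmoothVec _ (famPdx_mem_SmoothVec hΦ)))
    (smul_mem_SmoothVec _ (numP_mem_SmoothVec hΦ))

/-- The coefficients of a smooth vector decay rapidly. -/
theorem decay_of_mem_SmoothVec (k : ℕ) : ∀ {Φ}, Φ ∈ SmoothVec c μ ν →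
    ∃ C : ℝ, ∀ m (p : ℤ), (1 + |(p : ℝ)|) ^ k * ‖Φ m p‖ ≤ C := by
  induction k with
  | zero => intro Φ hΦ; simpa using exists_bound_of_mem_SmoothVec hΦ
  | succ k ih =>
    intro Φ hΦ
    obtain ⟨C, hC⟩ := ih hΦ
    obtain ⟨C', hC'⟩ := ih (numP_mem_SmoothVec hΦ)
    refine ⟨C + C', fun m p => ?_⟩
    have h1 := hC m p
    have h2 := hC' m p
    rw [numP, norm_mul, Complex.norm_intCast] at h2
    calc _ = (1 + |(p : ℝ)|) ^ k * ‖Φ m p‖ + (1 + |(p : ℝ)|) ^ k * (|(p : ℝ)| * ‖Φ m p‖) := by ring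
      _ ≤ _ := add_le_add h1 h2

/-! ### The `D`-valued inner product -/

section InnerD

variable {c : ℕ} {μ ν : ℝ} {f g : ℝ × ℝ → ℂ}

theorem hasSum_unique {ι : Type*} {a b : ι → ℂ} {A B : ℂ} (ha : HasSum a A) (hb : HasSum b B)
    (h : ∀ i, a i = b i) : A = B := by
  obtain rfl : a = b := funext h
  exact ha.unique hb

/-- The summands of the `D`-valued inner product. -/
def termD (c : ℕ) (μ ν : ℝ) (f g : ℝ × ℝ → ℂ) (m : ℝ × ℝ) (p k : ℤ) : ℂ :=
  conj (e (c * k * p * (m.2 - p * ν))) * f (m.1 + k, m.2)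
    * conj (g (m.1 - 2 * p * μ + k, m.2 - 2 * p * ν))

theorem norm_termD (f g : ℝ × ℝ → ℂ) (m : ℝ × ℝ) (p k : ℤ) : ‖termD c μ ν f g m p k‖ =
    ‖f (m.1 + k, m.2)‖ * ‖g (m.1 - 2 * p * μ + k, m.2 - 2 * p * ν)‖ := by
  simp only [termD, norm_mul, Complex.norm_conj, norm_e, one_mul]

/-- The points t and t - 2pμ are 2|p||μ| apart, so they cannot both be small for large p. Hence
decay of two functions in x becomes decay in p. -/
theorem one_add_abs_int_le (hμ : μ ≠ 0) (p : ℤ) (t : ℝ) :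
    1 + |(p : ℝ)| ≤ (1 + (2 * |μ|)⁻¹) * ((1 + |t|) * (1 + |t - 2 * p * μ|)) := by
  have hμ' : 0 < |μ| := abs_pos.2 hμ
  have h1 : 1 + |2 * (p : ℝ) * μ| ≤ (1 + |t|) * (1 + |t - 2 * p * μ|) := by
    have := one_add_abs_le (t - 2 * p * μ) (2 * p * μ)
    rwa [add_sub_cancel] at this
  refine le_trans ?_ (mul_le_mul_of_nonneg_left h1 (by positivity))
  rw [abs_mul, abs_mul, abs_two]
  have h2 : (2 * |μ|)⁻¹ * (2 * |(p : ℝ)| * |μ|) = |(p : ℝ)| := by field_simp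
  have h3 : 0 ≤ (2 * |μ|)⁻¹ := by positivity
  have h4 : 0 ≤ 2 * |(p : ℝ)| * |μ| := by positivity
  nlinarith

/-- Two powers of each weight pay for (1 + |p|)²; two further powers from `f` pay for summability in
`k`, hence the exponents 4 and 2. -/
theorem exists_termD_le (hμ : μ ≠ 0) (hf : f ∈ Xi) (hg : g ∈ Xi) :
    ∃ C : ℝ, 0 ≤ C ∧ ∀ m p k, ‖termD c μ ν f g m p k‖ ≤ C * (bw (m.1 + k) * bw p) := by
  obtain ⟨C1, h1⟩ := decay_one_add_of_mem_Xi 4 hf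
  obtain ⟨C2, h2⟩ := decay_one_add_of_mem_Xi 2 hg
  have hC1 : 0 ≤ C1 := le_trans (by positivity) (h1 (0, 0))
  have hC2 : 0 ≤ C2 := le_trans (by positivity) (h2 (0, 0))
  refine ⟨(1 + (2 * |μ|)⁻¹) ^ 2 * (C1 * C2), by positivity, fun m p k => ?_⟩
  rw [norm_termD]
  have k1 := h1 (m.1 + k, m.2)
  have k2 := h2 (m.1 - 2 * p * μ + k, m.2 - 2 * p * ν)
  have k3 := one_add_abs_int_le hμ p (m.1 + k)
  have heq : m.1 - 2 * p * μ + k = m.1 + k - 2 * p * μ := by ring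
  rw [heq] at k2 ⊢
  simp only at k1 k2
  set a := 1 + |m.1 + k|
  set b := 1 + |m.1 + k - 2 * p * μ|
  set F := ‖f (m.1 + k, m.2)‖
  set G := ‖g (m.1 + k - 2 * p * μ, m.2 - 2 * p * ν)‖
  have ha : 0 < a := by positivity
  have hb : 0 < b := by positivity
  simp only [bw]
  rw [← mul_inv, ← div_eq_mul_inv, le_div_iff₀ (by positivity)]
  calc F * G * (a ^ 2 * (1 + |(p : ℝ)|) ^ 2)
      ≤ F * G * (a ^ 2 * ((1 + (2 * |μ|)⁻¹) * (a * b)) ^ 2) := by gcongr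
    _ = (1 + (2 * |μ|)⁻¹) ^ 2 * ((a ^ 4 * F) * (b ^ 2 * G)) := by ring
    _ ≤ _ := by gcongr

theorem summable_termD (hμ : μ ≠ 0) (hf : f ∈ Xi) (hg : g ∈ Xi) (m : ℝ × ℝ) (p : ℤ) :
    Summable fun k => termD c μ ν f g m p k := by
  obtain ⟨C, -, hC⟩ := exists_termD_le (c := c) (ν := ν) hμ hf hg
  exact Summable.of_norm_bounded (((summable_bw_add m.1).mul_right (bw p)).mul_left C) (hC m p)

theorem hasSum_termD (hμ : μ ≠ 0) (hf : f ∈ Xi) (hg : g ∈ Xi) (m : ℝ × ℝ) (p : ℤ) :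
    HasSum (fun k => termD c μ ν f g m p k) (innerD c μ ν f g m p) :=
  (summable_termD hμ hf hg m p).hasSum

/-- Families of functions which decay like `(1 + |p|)⁻²`, uniformly. -/
def HasBwBound (Φ : ℝ × ℝ → ℤ → ℂ) : Prop := ∃ C : ℝ, 0 ≤ C ∧ ∀ m p, ‖Φ m p‖ ≤ C * bw p

theorem hasBwBound_innerD (hμ : μ ≠ 0) (hf : f ∈ Xi) (hg : g ∈ Xi) :
    HasBwBound (innerD c μ ν f g) := by
  obtain ⟨C, hC0, hC⟩ := exists_termD_le (c := c) (ν := ν) hμ hf hg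
  refine ⟨C * bwSum, mul_nonneg hC0 bwSum_nonneg, fun m p => ?_⟩
  have hs := (((summable_bw_add m.1).mul_right (bw p)).mul_left C).hasSum
  refine (tsum_of_norm_bounded hs (hC m p)).trans ?_
  rw [tsum_mul_left, tsum_mul_right, mul_assoc]
  exact mul_le_mul_of_nonneg_left
    (mul_le_mul_of_nonneg_right (tsum_bw_add_le m.1) (bw_nonneg _)) hC0

/-- The phase contributes the unbounded factor k in the y-derivative. Writing k = (x + k) - x
expresses it through the Schwartz function xf and a factor independent of `k`. -/
theorem hasPartials_termD (hf : f ∈ Xi) (hg : g ∈ Xi) (p k : ℤ) :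
    HasPartials (fun m => termD c μ ν f g m p k)
      (fun m => termD c μ ν (pdx f) g m p k + termD c μ ν f (pdx g) m p k)
      (fun m => termD c μ ν (pdy f) g m p k + termD c μ ν f (pdy g) m p k
        - 2 * Real.pi * Complex.I * c * p *
          (termD c μ ν (fun m => m.1 * f m) g m p k - m.1 * termD c μ ν f g m p k)) := by
  have h1 := (HasPartials.e_comp (c * k * p) (p * ν)).conjugate
  have h2 := (hasPartials_of_mem_Xi hf).comp_add k 0
  have h3 := ((hasPartials_of_mem_Xi hg).comp_add (-(2 * p * μ) + k) (-(2 * p * ν))).conjugate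
  have h := (h1.mul h2).mul h3
  simp only [add_zero, ← sub_eq_add_neg, ← add_assoc] at h
  refine h.of_eq (fun m => ?_) (fun m => ?_)
  · simp only [termD, map_zero]; ring
  · simp only [termD, map_mul, Complex.conj_I, Complex.conj_ofReal, map_ofNat, Complex.ofReal_add,
      Complex.ofReal_mul, Complex.ofReal_natCast, Complex.ofReal_intCast, map_natCast, map_intCast]
    ring

theorem hasPartials_innerD (hμ : μ ≠ 0) (hf : f ∈ Xi) (hg : g ∈ Xi) (p : ℤ) :
    HasPartials (fun m => innerD c μ ν f g m p)
      (fun m => innerD c μ ν (pdx f) g m p + innerD c μ ν f (pdx g) m p)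
      (fun m => innerD c μ ν (pdy f) g m p + innerD c μ ν f (pdy g) m p
        - 2 * Real.pi * Complex.I * c * p *
          (innerD c μ ν (fun m => m.1 * f m) g m p - m.1 * innerD c μ ν f g m p)) := by
  intro m
  have hfx := pdx_mem_Xi hf
  have hfy := pdy_mem_Xi hf
  have hgx := pdx_mem_Xi hg
  have hgy := pdy_mem_Xi hg
  have hxf := coord_mul_mem_Xi hf
  have H : ∀ {f g}, f ∈ Xi → g ∈ Xi → HasSum (fun k => termD c μ ν f g m p k)
      (innerD c μ ν f g m p) := fun hf hg => hasSum_termD hμ hf hg m p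
  have hsum := hasSum_lin2 ((H hfx hg).add (H hf hgx)) (((H hfy hg).add (H hf hgy)).sub
    (((H hxf hg).sub ((H hf hg).mul_left (m.1 : ℂ))).mul_left (2 * Real.pi * Complex.I * c * p)))
  rw [← hsum.tsum_eq]
  obtain ⟨C1, hC1, b1⟩ := exists_termD_le (c := c) (ν := ν) hμ hfx hg
  obtain ⟨C2, hC2, b2⟩ := exists_termD_le (c := c) (ν := ν) hμ hf hgx
  obtain ⟨C3, hC3, b3⟩ := exists_termD_le (c := c) (ν := ν) hμ hfy hg
  obtain ⟨C4, hC4, b4⟩ := exists_termD_le (c := c) (ν := ν) hμ hf hgy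
  obtain ⟨C5, hC5, b5⟩ := exists_termD_le (c := c) (ν := ν) hμ hxf hg
  obtain ⟨C6, hC6, b6⟩ := exists_termD_le (c := c) (ν := ν) hμ hf hg
  -- The factor x in the y-derivative has no global bound, so the series is differentiated on the
  -- strip |x| < A, which is convex and hence preconnected.
  set A : ℝ := |m.1| + 1
  set s : Set (ℝ × ℝ) := {m | |m.1| < A}
  have hs : IsOpen s := isOpen_lt (by fun_prop) continuous_const
  have hconv : Convex ℝ s := by
    have : s = (ContinuousLinearMap.fst ℝ ℝ ℝ) ⁻¹' Metric.ball 0 A := by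
      ext; simp [s]
    rw [this]
    exact (convex_ball (0 : ℝ) A).linear_preimage (ContinuousLinearMap.fst ℝ ℝ ℝ).toLinearMap
  set K : ℝ := ‖(2 * Real.pi * Complex.I * c * p : ℂ)‖
  have hK : 0 ≤ K := norm_nonneg _
  refine hasFDerivAt_tsum_of_isPreconnected (s := s) (x₀ := m) (x := m)
    (u := fun k : ℤ => (C1 + C2 + (C3 + C4 + K * (C5 + A * C6))) * ((1 + A) ^ 2 * bw k))
    ((summable_bw.mul_left _).mul_left _) hs hconv.isPreconnected
    (fun k m' _ => hasPartials_termD hf hg p k m') (fun k m' hm' => ?_) (by simp [s, A])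
    (summable_termD hμ hf hg m p) (by simp [s, A])
  set w := bw (m'.1 + k) * bw p
  have hw0 : 0 ≤ w := mul_nonneg (bw_nonneg _) (bw_nonneg _)
  have hw : w ≤ (1 + A) ^ 2 * bw k := by
    have h1 : w ≤ bw (m'.1 + k) := mul_le_of_le_one_right (bw_nonneg _) (bw_le_one _)
    have h2 := bw_add_le m'.1 k
    rw [add_comm] at h2
    refine h1.trans (h2.trans (mul_le_mul_of_nonneg_right ?_ (bw_nonneg _)))
    exact pow_le_pow_left₀ (by positivity) (by simpa using le_of_lt hm') 2
  refine (norm_lin2_le _ _).trans ?_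
  refine le_trans ?_ (mul_le_mul_of_nonneg_left hw (by positivity))
  have hx : ‖(m'.1 : ℂ)‖ ≤ A := by simpa using le_of_lt hm'
  have n1 : ‖termD c μ ν (pdx f) g m' p k + termD c μ ν f (pdx g) m' p k‖ ≤ (C1 + C2) * w := by
    rw [add_mul]; exact norm_add_le_of_le (b1 _ _ _) (b2 _ _ _)
  have n2 : ‖termD c μ ν (pdy f) g m' p k + termD c μ ν f (pdy g) m' p k‖ ≤ (C3 + C4) * w := by
    rw [add_mul]; exact norm_add_le_of_le (b3 _ _ _) (b4 _ _ _)
  have n3 : ‖termD c μ ν (fun m => m.1 * f m) g m' p k - m'.1 * termD c μ ν f g m' p k‖ ≤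
      (C5 + A * C6) * w := by
    rw [add_mul, mul_assoc]
    refine norm_sub_le_of_le (b5 _ _ _) ?_
    rw [norm_mul]
    exact mul_le_mul hx (b6 _ _ _) (norm_nonneg _) (by positivity)
  calc _ ≤ (C1 + C2) * w + ((C3 + C4) * w + K * ((C5 + A * C6) * w)) := by
        refine add_le_add n1 (norm_sub_le_of_le n2 ?_)
        rw [norm_mul]
        exact mul_le_mul_of_nonneg_left n3 hK
    _ = _ := by ring

/-- The connection `∇^0` is compatible with the `D`-valued inner product. -/
theorem delta_innerD (hμ : μ ≠ 0) (V : heis) (hf : f ∈ Xi) (hg : g ∈ Xi) :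
    delta c μ V (innerD c μ ν f g) =
      innerD c μ ν (nablaZero c μ V f) g + innerD c μ ν f (nablaZero c μ V g) := by
  funext m p
  have hfx := pdx_mem_Xi hf
  have hfy := pdy_mem_Xi hf
  have hgx := pdx_mem_Xi hg
  have hgy := pdy_mem_Xi hg
  have hxf := coord_mul_mem_Xi hf
  have H : ∀ {f g}, f ∈ Xi → g ∈ Xi → HasSum (fun k => termD c μ ν f g m p k)
      (innerD c μ ν f g m p) := fun hf hg => hasSum_termD hμ hf hg m p
  have hR := (H (nablaZero_mem_Xi c μ V hf) hg).add (H hf (nablaZero_mem_Xi c μ V hg))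
  have h0 := H hf hg
  have hx := (H hfx hg).add (H hf hgx)
  have hy := ((H hfy hg).add (H hf hgy)).sub
      (((H hxf hg).sub (h0.mul_left (m.1 : ℂ))).mul_left (2 * Real.pi * Complex.I * c * p))
  have hL := ((((h0.mul_left (2 * Real.pi * Complex.I * c * p * (m.1 - p * μ))).sub hy).mul_left
    (coordX V)).add (hx.neg.mul_left (coordY V))).add
      ((h0.mul_left (2 * Real.pi * Complex.I * p)).mul_left (coordZ c V))
  have hp := hasPartials_innerD (c := c) (ν := ν) hμ hf hg p
  have hμ' : (μ : ℂ) ≠ 0 := by exact_mod_cast hμ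
  -- Termwise, with u = x + k, this is (πci/2μ)(u² - (u - 2pμ)²) = 2πicp(u - pμ) for X and (πi/μ)(u
  -- - (u - 2pμ)) = 2πip for Z; conjugation of i provides the minus signs.
  have hLR := hasSum_unique hL hR fun k => by
    simp only [nablaZero_eq, termD, coordX, coordY, coordZ, map_add, map_mul, map_neg, map_div₀,
      map_pow, map_sub, map_intCast, Complex.conj_I, Complex.conj_ofReal, map_ofNat, map_natCast,
      Complex.ofReal_add,
      Complex.ofReal_sub, Complex.ofReal_mul, Complex.ofReal_natCast, Complex.ofReal_intCast,
      Complex.ofReal_ofNat]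
    field_simp
    ring
  rw [delta_eq]
  simp only [Pi.add_apply, Pi.smul_apply, famX, famPdx, numP, hp.pdx_eq, hp.pdy_eq, smul_eq_mul]
  linear_combination hLR

end InnerD

/-! ### Smooth maps into a space of bounded families -/

section LpInfty

variable {E ι : Type*} [NormedAddCommGroup E] [NormedSpace ℝ E]

/-- By the mean value inequality, derivative bounds uniform in the index on balls make the map
locally Lipschitz for the sup norm. -/
theorem continuous_lp_infty (U : E → lp (fun _ : ι => ℂ) ⊤) (L : E → ι → E →L[ℝ] ℂ)
    (hL : ∀ i x, HasFDerivAt (fun x => U x i) (L x i) x)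
    (hb : ∀ r : ℝ, ∃ C : ℝ, ∀ x, ‖x‖ ≤ r → ∀ i, ‖L x i‖ ≤ C) : Continuous U := by
  rw [continuous_iff_continuousAt]
  intro x
  obtain ⟨C, hC⟩ := hb (‖x‖ + 1)
  have hlip : ∀ y ∈ Metric.ball x 1, ‖U y - U x‖ ≤ max C 0 * ‖y - x‖ := by
    intro y hy
    refine lp.norm_le_of_forall_le (by positivity) fun i => ?_
    refine (convex_ball x 1).norm_image_sub_le_of_norm_hasFDerivWithin_le
      (f := fun x => U x i) (f' := fun z => L z i)
      (fun z _ => (hL i z).hasFDerivWithinAt) (fun z hz => (hC z ?_ i).trans (le_max_left _ _))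
      (Metric.mem_ball_self one_pos) hy
    have h1 : ‖z - x‖ < 1 := by rwa [← dist_eq_norm]
    have h2 := norm_add_le (z - x) x
    rw [sub_add_cancel] at h2
    linarith
  have h0 : Filter.Tendsto (fun y => max C 0 * ‖y - x‖) (nhds x) (nhds 0) := by
    have : Continuous fun y => max C 0 * ‖y - x‖ := by fun_prop
    simpa using this.tendsto x
  rw [ContinuousAt, tendsto_iff_norm_sub_tendsto_zero]
  refine squeeze_zero' (Filter.Eventually.of_forall fun _ => norm_nonneg _) ?_ h0
  filter_upwards [Metric.ball_mem_nhds x one_pos] with y hy using hlip y hy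

/-- Norm continuity of `U'` makes the coordinate derivatives nearly constant near `x`, uniformly in
the index, so the mean value inequality gives a uniform remainder. -/
theorem hasFDerivAt_lp_infty (U : E → lp (fun _ : ι => ℂ) ⊤)
    (U' : E → E →L[ℝ] lp (fun _ : ι => ℂ) ⊤) (hc : Continuous U') (L : E → ι → E →L[ℝ] ℂ)
    (hL : ∀ i x, HasFDerivAt (fun x => U x i) (L x i) x) (hLU : ∀ i x v, L x i v = U' x v i)
    (x : E) : HasFDerivAt U (U' x) x := by
  rw [hasFDerivAt_iff_isLittleO, Asymptotics.isLittleO_iff]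
  intro ε hε
  obtain ⟨δ, hδ, hball⟩ := Metric.continuousAt_iff.1 hc.continuousAt ε hε
  filter_upwards [Metric.ball_mem_nhds x hδ] with y hy
  refine lp.norm_le_of_forall_le (by positivity) fun i => ?_
  have := (convex_ball x δ).norm_image_sub_le_of_norm_hasFDerivWithin_le' (C := ε)
    (f := fun x => U x i) (f' := fun z => L z i) (φ := L x i)
    (fun z _ => (hL i z).hasFDerivWithinAt) (fun z hz => ?_) (Metric.mem_ball_self hδ) hy
  · rw [hLU] at this; exact this
  · refine ContinuousLinearMap.opNorm_le_bound _ hε.le fun v => ?_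
    rw [sub_apply, hLU, hLU]
    have h1 : ‖U' z - U' x‖ ≤ ε := by
      have := hball hz
      rw [dist_eq_norm] at this; exact this.le
    have h2 := lp.norm_apply_le_norm ENNReal.top_ne_zero ((U' z - U' x) v) i
    exact h2.trans ((U' z - U' x).le_of_opNorm_le h1 v)

end LpInfty

/-- Bounded families, indexed by the points of `(ℝ × ℝ) × ℤ`. -/
abbrev BddFam : Type := lp (fun _ : (ℝ × ℝ) × ℤ => ℂ) ⊤

/-! ### From bounded families to operators -/

section Operators

variable (μ ν : ℝ)

theorem shift_injective (q : ℤ) :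
    Function.Injective fun i : (ℝ × ℝ) × ℤ => (i.1, i.2 - q) := by
  rintro ⟨m, n⟩ ⟨m', n'⟩ h
  simp only [Prod.mk.injEq] at h ⊢
  exact ⟨h.1, by omega⟩

/-- An injective shift followed by a bounded multiplier. The factor 1 matches the shape required by
`LinearMap.mkContinuous₂`. -/
theorem sum_shift_le (q : ℤ) (a : BddFam) (ξ : Hilb) (s : Finset ((ℝ × ℝ) × ℤ)) :
    ∑ i ∈ s, ‖a (flow μ ν i.2 i.1, q) * ξ (i.1, i.2 - q)‖ ^ (2 : ENNReal).toReal ≤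
      (1 * ‖a‖ * ‖ξ‖) ^ (2 : ENNReal).toReal := by
  have h2 : (2 : ENNReal).toReal = 2 := by simp
  have h3 := lp.sum_rpow_le_norm_rpow (p := 2) (by simp) ξ
    (s.map ⟨fun i => (i.1, i.2 - q), shift_injective q⟩)
  rw [Finset.sum_map] at h3
  rw [one_mul, Real.mul_rpow (norm_nonneg _) (norm_nonneg _)]
  refine le_trans ?_ (mul_le_mul_of_nonneg_left h3 (by positivity))
  rw [Finset.mul_sum]
  refine Finset.sum_le_sum fun i _ => ?_
  rw [norm_mul, Real.mul_rpow (norm_nonneg _) (norm_nonneg _)]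
  refine mul_le_mul_of_nonneg_right ?_ (by positivity)
  exact Real.rpow_le_rpow (norm_nonneg _)
    (lp.norm_apply_le_norm ENNReal.top_ne_zero a _) (by simp)

theorem memℓp_shift (q : ℤ) (a : BddFam) (ξ : Hilb) :
    Memℓp (fun i : (ℝ × ℝ) × ℤ => a (flow μ ν i.2 i.1, q) * ξ (i.1, i.2 - q)) 2 :=
  memℓp_gen' (sum_shift_le μ ν q a ξ)

/-- The operator which represents a bounded family concentrated in degree `q`. -/
def opShift (q : ℤ) : BddFam →L[ℂ] Hilb →L[ℂ] Hilb :=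
  LinearMap.mkContinuous₂ (LinearMap.mk₂ ℂ (fun a ξ => (⟨_, memℓp_shift μ ν q a ξ⟩ : Hilb))
    (fun a b ξ => by ext i; exact add_mul _ _ _)
    (fun r a ξ => by ext i; exact mul_assoc _ _ _)
    (fun a ξ η => by ext i; exact mul_add _ _ _)
    (fun r a ξ => by ext i; exact mul_left_comm _ _ _)) 1
    fun a ξ => lp.norm_le_of_forall_sum_le (by simp) (by positivity) (sum_shift_le μ ν q a ξ)

theorem opShift_apply (q : ℤ) (a : BddFam) (ξ : Hilb) (m : ℝ × ℝ) (n : ℤ) :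
    opShift μ ν q a ξ (m, n) = a (flow μ ν n m, q) * ξ (m, n - q) := rfl

theorem norm_opShift_le (q : ℤ) : ‖opShift μ ν q‖ ≤ 1 :=
  LinearMap.mkContinuous₂_norm_le _ zero_le_one _

theorem exists_hasSum_bw_smul {E F : Type*} [NormedAddCommGroup E] [NormedSpace ℂ E]
    [NormedAddCommGroup F] [NormedSpace ℂ F] [CompleteSpace F] (T : ℤ → E →L[ℂ] F)
    (hT : ∀ q, ‖T q‖ ≤ 1) :
    ∃ S : E →L[ℂ] F, ∀ a, HasSum (fun q : ℤ => (bw q : ℂ) • T q a) (S a) := by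
  have h : Summable fun q : ℤ => (bw q : ℂ) • T q := by
    refine Summable.of_norm_bounded summable_bw fun q => ?_
    rw [norm_smul, Complex.norm_real, Real.norm_of_nonneg (bw_nonneg _)]
    exact mul_le_of_le_one_right (bw_nonneg _) (hT q)
  refine ⟨∑' q : ℤ, (bw q : ℂ) • T q, fun a => ?_⟩
  have h2 := (ContinuousLinearMap.apply ℂ F a).hasSum h.hasSum
  exact h2

/-- The operator which represents the family `(m, p) ↦ (1 + |p|)⁻² a(m, p)`. -/
def opFam : BddFam →L[ℂ] Hilb →L[ℂ] Hilb :=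
  Classical.choose (exists_hasSum_bw_smul (opShift μ ν) (norm_opShift_le μ ν))

theorem hasSum_opFam (a : BddFam) :
    HasSum (fun q : ℤ => (bw q : ℂ) • opShift μ ν q a) (opFam μ ν a) :=
  Classical.choose_spec (exists_hasSum_bw_smul (opShift μ ν) (norm_opShift_le μ ν)) a

theorem represents_opFam (a : BddFam) :
    Represents μ ν (opFam μ ν a) fun m p => bw p * a (m, p) := by
  intro ξ m n
  have h := ((lp.evalCLM ℂ (fun _ : (ℝ × ℝ) × ℤ => ℂ) 2 (m, n)).comp
    (ContinuousLinearMap.apply ℂ Hilb ξ)).hasSum (hasSum_opFam μ ν a)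
  have h2 : (fun q : ℤ => ((lp.evalCLM ℂ (fun _ : (ℝ × ℝ) × ℤ => ℂ) 2 (m, n)).comp
      (ContinuousLinearMap.apply ℂ Hilb ξ)) ((bw q : ℂ) • opShift μ ν q a)) =
      fun q : ℤ => bw q * a (flow μ ν n m, q) * ξ (m, n - q) := by
    funext q
    rw [map_smul, smul_eq_mul, mul_assoc, ← opShift_apply]; rfl
  rw [h2] at h
  exact h

theorem represents_sum_opShift (s : Finset ℤ) (a : BddFam) :
    Represents μ ν (∑ q ∈ s, (bw q : ℂ) • opShift μ ν q a)
      fun m p => if p ∈ s then bw p * a (m, p) else 0 := by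
  intro ξ m n
  have h1 : (∑ q ∈ s, (bw q : ℂ) • opShift μ ν q a) ξ (m, n) =
      ∑ q ∈ s, bw q * a (flow μ ν n m, q) * ξ (m, n - q) := by
    change ((lp.evalCLM ℂ (fun _ : (ℝ × ℝ) × ℤ => ℂ) 2 (m, n)).comp
      (ContinuousLinearMap.apply ℂ Hilb ξ)) (∑ q ∈ s, (bw q : ℂ) • opShift μ ν q a) = _
    rw [map_sum]
    refine Finset.sum_congr rfl fun q _ => ?_
    rw [map_smul, smul_eq_mul, mul_assoc, ← opShift_apply]; rfl
  rw [h1]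
  have h2 : ∑ q ∈ s, bw q * a (flow μ ν n m, q) * ξ (m, n - q) = ∑ q ∈ s,
      (if q ∈ s then (bw q * a (flow μ ν n m, q) : ℂ) else 0) * ξ (m, n - q) :=
    Finset.sum_congr rfl fun q hq => by rw [if_pos hq]
  rw [h2]
  exact hasSum_sum_of_ne_finset_zero fun q hq => by simp [hq]

end Operators

/-! ### Smoothness of orbits -/

section Orbits

variable {c : ℕ} {μ ν : ℝ} {Φ Ψ : ℝ × ℝ → ℤ → ℂ}

theorem memℓp_of_hasBwBound (h : HasBwBound Φ) :
    Memℓp (fun i : (ℝ × ℝ) × ℤ => Φ i.1 i.2 / bw i.2) ⊤ := by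
  obtain ⟨C, hC0, hC⟩ := h
  refine memℓp_infty ⟨C, ?_⟩
  rintro _ ⟨i, rfl⟩
  simp only [norm_div, Complex.norm_real, Real.norm_of_nonneg (bw_nonneg _)]
  rw [div_le_iff₀ (bw_pos _)]
  exact hC _ _

open Classical in
/-- The bounded family `(1 + |p|)² Φ(m, p)`, if it is bounded. -/
def toBdd (Φ : ℝ × ℝ → ℤ → ℂ) : BddFam :=
  if h : Memℓp (fun i : (ℝ × ℝ) × ℤ => Φ i.1 i.2 / bw i.2) ⊤ then ⟨_, h⟩ else 0

theorem toBdd_apply (h : HasBwBound Φ) (i : (ℝ × ℝ) × ℤ) : toBdd Φ i = Φ i.1 i.2 / bw i.2 := by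
  rw [toBdd, dif_pos (memℓp_of_hasBwBound h)]

theorem bw_mul_toBdd (h : HasBwBound Φ) (m : ℝ × ℝ) (p : ℤ) : bw p * toBdd Φ (m, p) = Φ m p := by
  rw [toBdd_apply h]
  have : (bw p : ℂ) ≠ 0 := by exact_mod_cast (bw_pos p).ne'
  field_simp

theorem norm_groupAct (h : ℝ × ℝ × ℝ) (m : ℝ × ℝ) (p : ℤ) :
    ‖groupAct c μ h Φ m p‖ = ‖Φ (m.1 - h.1, m.2 - h.2.1) p‖ := by
  simp only [groupAct, norm_mul, norm_e, one_mul]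

theorem HasBwBound.groupAct (hΦ : HasBwBound Φ) (h : ℝ × ℝ × ℝ) :
    HasBwBound (groupAct c μ h Φ) := by
  obtain ⟨C, hC0, hC⟩ := hΦ
  exact ⟨C, hC0, fun m p => by rw [norm_groupAct]; exact hC _ _⟩

theorem contDiff_lin3 {E F : Type*} [NormedAddCommGroup E] [NormedSpace ℝ E]
    [NormedAddCommGroup F] [NormedSpace ℝ F] {n : WithTop ℕ∞} {a b d : E → F}
    (ha : ContDiff ℝ n a) (hb : ContDiff ℝ n b) (hd : ContDiff ℝ n d) :
    ContDiff ℝ n fun h => lin3 (a h) (b h) (d h) := by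
  unfold lin3
  exact ((contDiff_const.smulRight ha).add (contDiff_const.smulRight hb)).add
    (contDiff_const.smulRight hd)

theorem norm_lin3_le {F : Type*} [NormedAddCommGroup F] [NormedSpace ℝ F] (a b d : F) :
    ‖lin3 a b d‖ ≤ ‖a‖ + ‖b‖ + ‖d‖ := by
  refine ContinuousLinearMap.opNorm_le_bound _ (by positivity) fun v => ?_
  rw [lin3_apply, add_mul, add_mul]
  refine (norm_add₃_le).trans (add_le_add (add_le_add ?_ ?_) ?_)
  all_goals rw [norm_smul, mul_comm]; refine mul_le_mul_of_nonneg_left ?_ (norm_nonneg _)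
  · exact norm_fst_le v
  · exact (norm_fst_le v.2).trans (norm_snd_le v)
  · exact (norm_snd_le v.2).trans (norm_snd_le v)

/-- In a class of families which decay in `p` and which is closed under the derivations, all
orbits under the group action are smooth. -/
theorem contDiff_toBdd_groupAct (𝒮 : Set (ℝ × ℝ → ℤ → ℂ)) (hbd : ∀ Φ ∈ 𝒮, HasBwBound Φ)
    (hpart : ∀ Φ ∈ 𝒮, ∀ p, HasPartials (fun m => Φ m p) (pdx fun m => Φ m p) (pdy fun m => Φ m p))
    (hP : ∀ Φ ∈ 𝒮, numP Φ ∈ 𝒮) (hX : ∀ Φ ∈ 𝒮, famX c μ Φ ∈ 𝒮) (hY : ∀ Φ ∈ 𝒮, famPdx Φ ∈ 𝒮)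
    (hΦ : Φ ∈ 𝒮) : ContDiff ℝ ∞ fun h => toBdd (groupAct c μ h Φ) := by
  set U : (ℝ × ℝ → ℤ → ℂ) → ℝ × ℝ × ℝ → BddFam := fun Φ h => toBdd (groupAct c μ h Φ) with hU
  set b : ℝ × ℝ × ℝ → ℝ := fun h => -(c * h.2.1) with hb
  have hbs : ∀ n : WithTop ℕ∞, ContDiff ℝ n b := fun n => by rw [hb]; fun_prop
  set U' : (ℝ × ℝ → ℤ → ℂ) → ℝ × ℝ × ℝ → (ℝ × ℝ × ℝ →L[ℝ] BddFam) := fun Φ h =>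
    lin3 (-U (famPdx Φ) h + b h • ((2 * Real.pi * Complex.I : ℂ) • U (numP Φ) h))
      (U (famX c μ Φ) h) ((2 * Real.pi * Complex.I : ℂ) • U (numP Φ) h) with hU'
  have hcoord : ∀ Φ ∈ 𝒮, ∀ (i : (ℝ × ℝ) × ℤ) (h : ℝ × ℝ × ℝ), HasFDerivAt (fun h => U Φ h i)
      (lin3 (U' Φ h (1, 0, 0) i) (U' Φ h (0, 1, 0) i) (U' Φ h (0, 0, 1) i)) h := by
    intro Φ hΦ i h
    have h1 := (hasFDerivAt_groupAct (c := c) (μ := μ) (hpart Φ hΦ i.2) i.1 h).const_mul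
      ((bw i.2 : ℂ)⁻¹)
    have h2 : (fun h => U Φ h i) = fun h => (bw i.2 : ℂ)⁻¹ * groupAct c μ h Φ i.1 i.2 := by
      funext h; rw [hU]; simp only [toBdd_apply ((hbd Φ hΦ).groupAct h)]; ring
    rw [h2]
    refine h1.congr_fderiv ?_
    have e1 : ∀ Ψ ∈ 𝒮, ∀ h, U Ψ h i = (bw i.2 : ℂ)⁻¹ * groupAct c μ h Ψ i.1 i.2 := by
      intro Ψ hΨ h; rw [hU]; simp only [toBdd_apply ((hbd Ψ hΨ).groupAct h)]; ring
    have e2 : U' Φ h (1, 0, 0) i = -U (famPdx Φ) h i +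
        b h • ((2 * Real.pi * Complex.I : ℂ) * U (numP Φ) h i) := by
      simp only [hU', lin3_apply, one_smul, zero_smul, add_zero]; rfl
    rw [e2]
    ext
    · simp [e1 _ (hP Φ hΦ), e1 _ (hY Φ hΦ), hb]; ring
    · simp [hU', e1 _ (hX Φ hΦ)]
    · simp [hU', e1 _ (hP Φ hΦ)]; ring
  -- Translations and phases preserve the weighted bounds, so only the coefficient cs of the
  -- r-derivative grows with `h`; it is bounded on balls.
  have hcont : ∀ Φ ∈ 𝒮, Continuous (U Φ) := by
    intro Φ hΦ
    refine continuous_lp_infty _ (fun h i =>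
      lin3 (U' Φ h (1, 0, 0) i) (U' Φ h (0, 1, 0) i) (U' Φ h (0, 0, 1) i)) (hcoord Φ hΦ) fun r => ?_
    have hUb : ∀ Ψ ∈ 𝒮, ∃ C : ℝ, ∀ h, ‖U Ψ h‖ ≤ C := by
      intro Ψ hΨ
      obtain ⟨C, hC0, hC⟩ := hbd Ψ hΨ
      refine ⟨C, fun h => lp.norm_le_of_forall_le hC0 fun i => ?_⟩
      rw [hU]
      simp only [toBdd_apply ((hbd Ψ hΨ).groupAct h), norm_div, Complex.norm_real,
        Real.norm_of_nonneg (bw_nonneg _), norm_groupAct]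
      rw [div_le_iff₀ (bw_pos _)]
      exact hC _ _
    obtain ⟨C1, h1⟩ := hUb _ (hY Φ hΦ)
    obtain ⟨C2, h2⟩ := hUb _ (hP Φ hΦ)
    obtain ⟨C3, h3⟩ := hUb _ (hX Φ hΦ)
    have hC2 : 0 ≤ C2 := (norm_nonneg _).trans (h2 0)
    set K : ℝ := ‖(2 * Real.pi * Complex.I : ℂ)‖
    have hK : 0 ≤ K := norm_nonneg _
    have hl : ∀ (a : BddFam) i, ‖a i‖ ≤ ‖a‖ := lp.norm_apply_le_norm ENNReal.top_ne_zero
    refine ⟨(C1 + c * r * (K * C2)) + C3 + K * C2, fun h hh i => (norm_lin3_le _ _ _).trans ?_⟩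
    have hbh : ‖b h‖ ≤ c * r := by
      rw [hb]
      simp only [norm_neg, norm_mul, Real.norm_natCast]
      exact mul_le_mul_of_nonneg_left
        (((norm_fst_le h.2).trans (norm_snd_le h)).trans hh) (by positivity)
    have hK2 : ‖(2 * Real.pi * Complex.I : ℂ) • U (numP Φ) h‖ ≤ K * C2 := by
      rw [norm_smul]; exact mul_le_mul_of_nonneg_left (h2 h) hK
    refine add_le_add (add_le_add ((hl _ _).trans ?_) ((hl _ _).trans ?_)) ((hl _ _).trans ?_)
    · simp only [hU', lin3_apply, one_smul, zero_smul, add_zero]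
      refine norm_add_le_of_le (by rw [norm_neg]; exact h1 h) ?_
      rw [norm_smul]
      exact mul_le_mul hbh hK2 (norm_nonneg _) ((norm_nonneg _).trans hbh)
    · simp only [hU', lin3_apply, one_smul, zero_smul, add_zero, zero_add]
      exact h3 h
    · simp only [hU', lin3_apply, one_smul, zero_smul, zero_add]
      exact hK2
  have hU's : ∀ n : ℕ, (∀ Φ ∈ 𝒮, ContDiff ℝ n (U Φ)) → ∀ Φ ∈ 𝒮, ContDiff ℝ n (U' Φ) := by
    intro n hn Φ hΦ
    exact contDiff_lin3 ((hn _ (hY Φ hΦ)).neg.add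
      ((hbs n).fun_smul ((hn _ (hP Φ hΦ)).const_smul (2 * Real.pi * Complex.I : ℂ))))
      (hn _ (hX Φ hΦ)) ((hn _ (hP Φ hΦ)).const_smul (2 * Real.pi * Complex.I : ℂ))
  have hderiv : ∀ Φ ∈ 𝒮, ∀ h, HasFDerivAt (U Φ) (U' Φ h) h := by
    intro Φ hΦ
    have h0 := hU's 0 (fun Ψ hΨ => contDiff_zero.2 (hcont Ψ hΨ)) Φ hΦ
    refine hasFDerivAt_lp_infty _ _ h0.continuous _ (hcoord Φ hΦ) fun i h v => ?_
    have hv : v = v.1 • ((1, 0, 0) : ℝ × ℝ × ℝ) + v.2.1 • ((0, 1, 0) : ℝ × ℝ × ℝ) +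
        v.2.2 • ((0, 0, 1) : ℝ × ℝ × ℝ) := by ext <;> simp
    conv_rhs => rw [hv]
    rw [map_add, map_add, map_smul, map_smul, map_smul, lin3_apply]
    rfl
  -- The derivative `U'` is assembled from `U` of other members of the class, so C^n for the whole
  -- class gives C^(n+1).
  have key : ∀ n : ℕ, ∀ Φ ∈ 𝒮, ContDiff ℝ n (U Φ) := by
    intro n
    induction n with
    | zero => exact fun Φ hΦ => contDiff_zero.2 (hcont Φ hΦ)
    | succ n ih =>
      intro Φ hΦ
      push_cast
      exact contDiff_succ_iff_hasFDerivAt.2 ⟨_, hU's n ih Φ hΦ, hderiv Φ hΦ⟩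
  exact contDiff_infty.2 fun n => key n Φ hΦ

/-- Covariant, differentiable families which decay belong to `D`. -/
theorem opFam_mem_closure (hcov : Covariant c ν Φ) (hc : ∀ p, Continuous fun m => Φ m p)
    (hb : HasBwBound Φ) :
    opFam μ ν (toBdd Φ) ∈ closure {S | ∃ Ψ ∈ DZero c ν, Represents μ ν S Ψ} := by
  -- The approximants truncate to finitely many degrees p, which keeps covariance and lands in D_0.
  refine mem_closure_of_tendsto (hasSum_opFam μ ν (toBdd Φ))
    (Filter.Eventually.of_forall fun s => ?_)
  refine ⟨_, ?_, represents_sum_opShift μ ν s (toBdd Φ)⟩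
  simp only [bw_mul_toBdd hb]
  refine ⟨fun p => ?_, fun x y p => by simp only [hcov.1], ?_, fun k x y p => ?_⟩
  · by_cases h : p ∈ s
    · simpa only [h, if_true] using hc p
    · simpa only [h, if_false] using continuous_const
  · refine s.finite_toSet.subset ?_
    rintro p ⟨m, hm⟩
    by_contra h
    exact hm (if_neg h)
  · rw [covariant_iff_conj]
    by_cases h : p ∈ s <;> simp only [h, if_true, if_false]
    · exact hcov.2 k x y p
    · simp

theorem mem_DSmooth_of_class (𝒮 : Set (ℝ × ℝ → ℤ → ℂ)) (hbd : ∀ Φ ∈ 𝒮, HasBwBound Φ)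
    (hpart : ∀ Φ ∈ 𝒮, ∀ p, HasPartials (fun m => Φ m p) (pdx fun m => Φ m p) (pdy fun m => Φ m p))
    (hP : ∀ Φ ∈ 𝒮, numP Φ ∈ 𝒮) (hX : ∀ Φ ∈ 𝒮, famX c μ Φ ∈ 𝒮) (hY : ∀ Φ ∈ 𝒮, famPdx Φ ∈ 𝒮)
    (hΦ : Φ ∈ 𝒮) (hcov : Covariant c ν Φ) : Φ ∈ DSmooth c μ ν := by
  have hrep : ∀ {Ψ}, HasBwBound Ψ → Represents μ ν (opFam μ ν (toBdd Ψ)) Ψ := by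
    intro Ψ h
    have := represents_opFam μ ν (toBdd Ψ)
    simp only [bw_mul_toBdd h] at this
    exact this
  refine ⟨⟨_, hrep (hbd Φ hΦ), opFam_mem_closure hcov (fun p => (hpart Φ hΦ p).continuous)
    (hbd Φ hΦ)⟩, fun h => opFam μ ν (toBdd (groupAct c μ h Φ)),
    fun h => hrep ((hbd Φ hΦ).groupAct h), ?_⟩
  exact ((opFam μ ν).restrictScalars ℝ).contDiff.comp
    (contDiff_toBdd_groupAct 𝒮 hbd hpart hP hX hY hΦ)

end Orbits

/-! ### Inner products are smooth -/

section InnerSmooth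

variable {c : ℕ} {μ ν : ℝ} {f g : ℝ × ℝ → ℂ}

theorem covariant_innerD (hf : f ∈ Xi) (hg : g ∈ Xi) : Covariant c ν (innerD c μ ν f g) := by
  refine ⟨fun x y p => tsum_congr fun k => ?_, fun k x y p => ?_⟩
  · have h1 : (c * k * p * (y + 1 - p * ν) : ℝ) = c * k * p * (y - p * ν) + ((c * k * p : ℤ) : ℝ) := by
      push_cast; ring
    have h2 : y + 1 - 2 * p * ν = y - 2 * p * ν + 1 := by ring
    simp only [h1, h2, e_add_int, hf.2.1, hg.2.1]
  · change ∑' j, termD c μ ν f g (x + k, y) p j = _ * ∑' j, termD c μ ν f g (x, y) p j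
    -- Translation by k only reindexes the sum; the phase splits off because it is additive in the
    -- summation index.
    rw [← (Equiv.addLeft k).tsum_eq (termD c μ ν f g (x, y) p), ← tsum_mul_left]
    refine tsum_congr fun j => ?_
    have h1 : (c * ((k + j : ℤ) : ℝ) * p * (y - p * ν) : ℝ) =
        c * k * p * (y - p * ν) + c * j * p * (y - p * ν) := by push_cast; ring
    have h2 : x + ((k + j : ℤ) : ℝ) = x + k + j := by push_cast; ring
    have h3 : x - 2 * p * μ + ((k + j : ℤ) : ℝ) = x + k - 2 * p * μ + j := by push_cast; ring
    simp only [termD, Equiv.coe_addLeft, h1, h2, h3, e_add, map_mul]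
    have h4 : e (c * k * p * (y - p * ν)) * conj (e (c * k * p * (y - p * ν))) = 1 := by
      rw [conj_e, e_mul_e_neg]
    linear_combination (-(conj (e (c * j * p * (y - p * ν))) * f (x + k + j, y) *
      conj (g (x + k - 2 * p * μ + j, y - 2 * p * ν)))) * h4

theorem HasPartials.canonical {f f₁ f₂ : ℝ × ℝ → ℂ} (h : HasPartials f f₁ f₂) :
    HasPartials f (pdx f) (pdy f) := by
  rw [h.pdx_eq, h.pdy_eq]; exact h

@[simp] theorem coordX_basisX : coordX basisX = 1 := by simp [coordX, basisX]
@[simp] theorem coordY_basisX : coordY basisX = 0 := by simp [coordY, basisX]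
@[simp] theorem coordZ_basisX : coordZ c basisX = 0 := by simp [coordZ, basisX]
@[simp] theorem coordX_basisY : coordX basisY = 0 := by simp [coordX, basisY]
@[simp] theorem coordY_basisY : coordY basisY = 1 := by simp [coordY, basisY]
@[simp] theorem coordZ_basisY : coordZ c basisY = 0 := by simp [coordZ, basisY]
@[simp] theorem coordX_basisZ : coordX (basisZ c) = 0 := by simp [coordX, basisZ]
@[simp] theorem coordY_basisZ : coordY (basisZ c) = 0 := by simp [coordY, basisZ]

theorem coordZ_basisZ (hc : 0 < c) : coordZ c (basisZ c) = 1 := by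
  have : (c : ℂ) ≠ 0 := by exact_mod_cast hc.ne'
  simp [coordZ, basisZ, this]

/-- The linear span of the inner products of Schwartz functions. -/
def innerSpan (c : ℕ) (μ ν : ℝ) : Submodule ℂ (ℝ × ℝ → ℤ → ℂ) :=
  Submodule.span ℂ {Φ | ∃ f ∈ Xi, ∃ g ∈ Xi, Φ = innerD c μ ν f g}

theorem innerD_mem_innerSpan (hf : f ∈ Xi) (hg : g ∈ Xi) :
    innerD c μ ν f g ∈ innerSpan c μ ν := Submodule.subset_span ⟨f, hf, g, hg, rfl⟩

/-- The span is needed because a derivation sends one inner product to a sum of two. -/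
theorem innerSpan_properties (hμ : μ ≠ 0) {Φ : ℝ × ℝ → ℤ → ℂ} (hΦ : Φ ∈ innerSpan c μ ν) :
    HasBwBound Φ ∧
      (∀ p, HasPartials (fun m => Φ m p) (pdx fun m => Φ m p) (pdy fun m => Φ m p)) ∧
      ∀ V, delta c μ V Φ ∈ innerSpan c μ ν := by
  induction hΦ using Submodule.span_induction with
  | mem Φ h =>
    obtain ⟨f, hf, g, hg, rfl⟩ := h
    refine ⟨hasBwBound_innerD hμ hf hg, fun p => (hasPartials_innerD hμ hf hg p).canonical,
      fun V => ?_⟩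
    rw [delta_innerD hμ V hf hg]
    exact add_mem (innerD_mem_innerSpan (nablaZero_mem_Xi c μ V hf) hg)
      (innerD_mem_innerSpan hf (nablaZero_mem_Xi c μ V hg))
  | zero =>
    refine ⟨⟨0, le_rfl, fun m p => by simp⟩, fun p => .of_contDiff contDiff_const, fun V => ?_⟩
    have : delta c μ V 0 = 0 := by funext m p; simp [delta]
    rw [this]; exact zero_mem _
  | add Φ Ψ _ _ h h' =>
    obtain ⟨⟨C, hC0, hC⟩, hp, hd⟩ := h
    obtain ⟨⟨C', hC0', hC'⟩, hp', hd'⟩ := h'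
    refine ⟨⟨C + C', by positivity, fun m p => ?_⟩, fun p => ((hp p).add (hp' p)).canonical,
      fun V => ?_⟩
    · rw [add_mul]; exact norm_add_le_of_le (hC m p) (hC' m p)
    · have : delta c μ V (Φ + Ψ) = delta c μ V Φ + delta c μ V Ψ := by
        funext m p
        have e1 := congrFun ((hp p).add (hp' p)).pdx_eq m
        have e2 := congrFun ((hp p).add (hp' p)).pdy_eq m
        simp only [delta_eq, famX, famPdx, numP, Pi.add_apply, Pi.smul_apply, smul_eq_mul, e1, e2]
        ring
      rw [this]; exact add_mem (hd V) (hd' V)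
  | smul a Φ _ h =>
    obtain ⟨⟨C, hC0, hC⟩, hp, hd⟩ := h
    refine ⟨⟨‖a‖ * C, by positivity, fun m p => ?_⟩, fun p => ((hp p).const_mul a).canonical,
      fun V => ?_⟩
    · rw [mul_assoc]
      exact (norm_smul_le a (Φ m p)).trans (mul_le_mul_of_nonneg_left (hC m p) (norm_nonneg _))
    · have : delta c μ V (a • Φ) = a • delta c μ V Φ := by
        funext m p
        have e1 := congrFun ((hp p).const_mul a).pdx_eq m
        have e2 := congrFun ((hp p).const_mul a).pdy_eq m
        simp only [delta_eq, famX, famPdx, numP, Pi.add_apply, Pi.smul_apply, smul_eq_mul, e1, e2]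
        ring
      rw [this]; exact Submodule.smul_mem _ a (hd V)

theorem innerD_mem_DSmooth (hc : 0 < c) (hμ : μ ≠ 0) (hf : f ∈ Xi) (hg : g ∈ Xi) :
    innerD c μ ν f g ∈ DSmooth c μ ν := by
  refine mem_DSmooth_of_class (innerSpan c μ ν : Set (ℝ × ℝ → ℤ → ℂ))
    (fun Φ hΦ => (innerSpan_properties hμ hΦ).1) (fun Φ hΦ => (innerSpan_properties hμ hΦ).2.1)
    (fun Φ hΦ => ?_) (fun Φ hΦ => ?_) (fun Φ hΦ => ?_) (innerD_mem_innerSpan hf hg)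
    (covariant_innerD hf hg)
  -- The three operations of the class are δ_Z/(2πi), δ_X and -δ_Y.
  · have h := Submodule.smul_mem _ (2 * Real.pi * Complex.I : ℂ)⁻¹
      ((innerSpan_properties hμ hΦ).2.2 (basisZ c))
    simp only [delta_eq, coordX_basisZ, coordY_basisZ, coordZ_basisZ hc, zero_smul, neg_zero,
      zero_add, one_mul, smul_smul] at h
    rwa [inv_mul_cancel₀ Complex.two_pi_I_ne_zero, one_smul] at h
  · have h := (innerSpan_properties hμ hΦ).2.2 basisX
    simpa [delta_eq] using h
  · have h := neg_mem ((innerSpan_properties hμ hΦ).2.2 basisY)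
    simpa [delta_eq] using h

end InnerSmooth

/-! ### The module action -/

section Action

variable {c : ℕ} {μ ν : ℝ} {f : ℝ × ℝ → ℂ} {Φ : ℝ × ℝ → ℤ → ℂ}

/-- The summands of the right action of `D` on `Ξ`. -/
def termA (μ ν : ℝ) (f : ℝ × ℝ → ℂ) (Φ : ℝ × ℝ → ℤ → ℂ) (m : ℝ × ℝ) (q : ℤ) : ℂ :=
  f (flow μ ν q m) * conj (Φ (flow μ ν q m) q)

/-- The weight at m is traded for the weight at λ_q m times (1 + |q|)^k, so decay of order k + 2 in
Φ leaves a summable remainder. -/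
theorem exists_termA_le (k : ℕ) (hf : f ∈ Xi) (hΦ : Φ ∈ SmoothVec c μ ν) :
    ∃ C : ℝ, 0 ≤ C ∧ ∀ m q, (1 + |m.1|) ^ k * ‖termA μ ν f Φ m q‖ ≤ C * bw q := by
  obtain ⟨C1, h1⟩ := decay_one_add_of_mem_Xi k hf
  obtain ⟨C2, h2⟩ := decay_of_mem_SmoothVec (k + 2) hΦ
  have hC1 : 0 ≤ C1 := le_trans (by positivity) (h1 (0, 0))
  have hC2 : 0 ≤ C2 := le_trans (by positivity) (h2 (0, 0) 0)
  refine ⟨(1 + 2 * |μ|) ^ k * (C1 * C2), by positivity, fun m q => ?_⟩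
  have k1 := h1 (flow μ ν q m)
  have k2 := h2 (flow μ ν q m) q
  have k3 := one_add_abs_le (2 * q * μ) m.1
  have k4 : 1 + |2 * (q : ℝ) * μ| ≤ (1 + 2 * |μ|) * (1 + |(q : ℝ)|) := by
    rw [abs_mul, abs_mul, abs_two]
    nlinarith [abs_nonneg μ, abs_nonneg (q : ℝ)]
  rw [termA, norm_mul, Complex.norm_conj]
  set F := ‖f (flow μ ν q m)‖
  set G := ‖Φ (flow μ ν q m) q‖
  simp only [flow] at k1
  set a := 1 + |m.1 + 2 * q * μ|
  set b := 1 + |(q : ℝ)|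
  have ha : 0 < a := by positivity
  have hb : 0 < b := by positivity
  rw [bw, ← div_eq_mul_inv, le_div_iff₀ (by positivity)]
  calc (1 + |m.1|) ^ k * (F * G) * b ^ 2
      ≤ (a * ((1 + 2 * |μ|) * b)) ^ k * (F * G) * b ^ 2 := by
        gcongr
        exact k3.trans (mul_le_mul_of_nonneg_left k4 ha.le)
    _ = (1 + 2 * |μ|) ^ k * ((a ^ k * F) * (b ^ (k + 2) * G)) := by
        simp only [mul_pow]; ring
    _ ≤ _ := by gcongr

theorem exists_norm_termA_le (hf : f ∈ Xi) (hΦ : Φ ∈ SmoothVec c μ ν) :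
    ∃ C : ℝ, 0 ≤ C ∧ ∀ m q, ‖termA μ ν f Φ m q‖ ≤ C * bw q := by
  simpa using exists_termA_le 0 hf hΦ

theorem hasSum_termA (hf : f ∈ Xi) (hΦ : Φ ∈ SmoothVec c μ ν) (m : ℝ × ℝ) :
    HasSum (fun q => termA μ ν f Φ m q) (actD μ ν f Φ m) := by
  obtain ⟨C, -, hC⟩ := exists_norm_termA_le hf hΦ
  exact (Summable.of_norm_bounded (summable_bw.mul_left C) (hC m)).hasSum

theorem actD_decay (hf : f ∈ Xi) (hΦ : Φ ∈ SmoothVec c μ ν) (k : ℕ) :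
    ∃ C : ℝ, ∀ m, |m.1| ^ k * ‖actD μ ν f Φ m‖ ≤ C := by
  obtain ⟨C, hC0, hC⟩ := exists_termA_le k hf hΦ
  refine ⟨C * ∑' q : ℤ, bw q, fun m => ?_⟩
  have h1 : ‖actD μ ν f Φ m‖ ≤ ((1 + |m.1|) ^ k)⁻¹ * (C * ∑' q : ℤ, bw q) := by
    refine tsum_of_norm_bounded ((summable_bw.hasSum.mul_left C).mul_left _) fun q => ?_
    rw [← div_eq_inv_mul, le_div_iff₀ (by positivity), mul_comm]
    exact hC m q
  have h2 : |m.1| ^ k ≤ (1 + |m.1|) ^ k :=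
    pow_le_pow_left₀ (abs_nonneg _) (by linarith) k
  calc _ ≤ (1 + |m.1|) ^ k * (((1 + |m.1|) ^ k)⁻¹ * (C * ∑' q : ℤ, bw q)) :=
        mul_le_mul h2 h1 (norm_nonneg _) (by positivity)
    _ = _ := by
        rw [← mul_assoc, mul_inv_cancel₀ (by positivity), one_mul]

/-- The coefficientwise y-derivative is replaced by 2πicq(x - qμ)Φ - δ_XΦ; the factor x goes to `f`
and the powers of q go to Φ, so every term is again of the form ξ·Ψ. -/
theorem hasPartials_termA (hf : f ∈ Xi) (hΦ : Φ ∈ SmoothVec c μ ν) (q : ℤ) :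
    HasPartials (fun m => termA μ ν f Φ m q)
      (fun m => termA μ ν (pdx f) Φ m q + termA μ ν f (famPdx Φ) m q)
      (fun m => termA μ ν (pdy f) Φ m q - 2 * Real.pi * Complex.I * c *
        (termA μ ν (fun m => m.1 * f m) (numP Φ) m q - μ * termA μ ν f (numP (numP Φ)) m q)
        - termA μ ν f (famX c μ Φ) m q) := by
  have h := ((hasPartials_of_mem_Xi hf).comp_add (2 * q * μ) (2 * q * ν)).mul
    ((hasPartials_of_mem_SmoothVec hΦ q).comp_add (2 * q * μ) (2 * q * ν)).conjugate
  refine h.of_eq (fun m => rfl) (fun m => ?_)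
  simp only [termA, flow, numP, famX, map_add, map_sub, map_mul, Complex.conj_I, Complex.conj_ofReal,
    map_ofNat, map_natCast, map_intCast, Complex.ofReal_add, Complex.ofReal_mul,
    Complex.ofReal_intCast, Complex.ofReal_ofNat]
  ring

theorem hasPartials_actD (hf : f ∈ Xi) (hΦ : Φ ∈ SmoothVec c μ ν) :
    HasPartials (actD μ ν f Φ)
      (fun m => actD μ ν (pdx f) Φ m + actD μ ν f (famPdx Φ) m)
      (fun m => actD μ ν (pdy f) Φ m - 2 * Real.pi * Complex.I * c *
        (actD μ ν (fun m => m.1 * f m) (numP Φ) m - μ * actD μ ν f (numP (numP Φ)) m)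
        - actD μ ν f (famX c μ Φ) m) := by
  intro m
  have hfx := pdx_mem_Xi hf
  have hfy := pdy_mem_Xi hf
  have hxf := coord_mul_mem_Xi hf
  have hP := numP_mem_SmoothVec hΦ
  have hPP := numP_mem_SmoothVec hP
  have hX := famX_mem_SmoothVec hΦ
  have hY := famPdx_mem_SmoothVec hΦ
  have hsum := hasSum_lin2 ((hasSum_termA hfx hΦ m).add (hasSum_termA hf hY m))
    (((hasSum_termA hfy hΦ m).sub (((hasSum_termA hxf hP m).sub
      ((hasSum_termA hf hPP m).mul_left (μ : ℂ))).mul_left (2 * Real.pi * Complex.I * c))).sub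
      (hasSum_termA hf hX m))
  rw [← hsum.tsum_eq]
  obtain ⟨C1, hC1, b1⟩ := exists_norm_termA_le hfx hΦ
  obtain ⟨C2, hC2, b2⟩ := exists_norm_termA_le hf hY
  obtain ⟨C3, hC3, b3⟩ := exists_norm_termA_le hfy hΦ
  obtain ⟨C4, hC4, b4⟩ := exists_norm_termA_le hxf hP
  obtain ⟨C5, hC5, b5⟩ := exists_norm_termA_le hf hPP
  obtain ⟨C6, hC6, b6⟩ := exists_norm_termA_le hf hX
  set K : ℝ := ‖(2 * Real.pi * Complex.I * c : ℂ)‖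
  have hK : 0 ≤ K := norm_nonneg _
  refine hasFDerivAt_tsum
    (u := fun q : ℤ => (C1 + C2 + (C3 + K * (C4 + ‖(μ : ℂ)‖ * C5) + C6)) * bw q)
    (summable_bw.mul_left _) (fun q m' => hasPartials_termA hf hΦ q m') (fun q m' => ?_)
    (hasSum_termA hf hΦ m).summable m
  refine (norm_lin2_le _ _).trans ?_
  have n1 : ‖termA μ ν (pdx f) Φ m' q + termA μ ν f (famPdx Φ) m' q‖ ≤ (C1 + C2) * bw q := by
    rw [add_mul]; exact norm_add_le_of_le (b1 _ _) (b2 _ _)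
  have n2 : ‖termA μ ν (fun m => m.1 * f m) (numP Φ) m' q -
      μ * termA μ ν f (numP (numP Φ)) m' q‖ ≤ (C4 + ‖(μ : ℂ)‖ * C5) * bw q := by
    rw [add_mul, mul_assoc]
    refine norm_sub_le_of_le (b4 _ _) ?_
    rw [norm_mul]
    exact mul_le_mul_of_nonneg_left (b5 _ _) (norm_nonneg _)
  calc _ ≤ (C1 + C2) * bw q +
        (C3 * bw q + K * ((C4 + ‖(μ : ℂ)‖ * C5) * bw q) + C6 * bw q) := by
        refine add_le_add n1 (norm_sub_le_of_le (norm_sub_le_of_le (b3 _ _) ?_) (b6 _ _))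
        rw [norm_mul]
        exact mul_le_mul_of_nonneg_left n2 hK
    _ = _ := by ring

theorem actD_periodic (hf : f ∈ Xi) (hΦ : Φ ∈ SmoothVec c μ ν) (x y : ℝ) :
    actD μ ν f Φ (x, y + 1) = actD μ ν f Φ (x, y) := by
  refine tsum_congr fun q => ?_
  have : y + 1 + 2 * q * ν = y + 2 * q * ν + 1 := by ring
  simp only [flow, this, hf.2.1, hΦ.1.1]

theorem actD_mem_Xi (hf : f ∈ Xi) (hΦ : Φ ∈ SmoothVec c μ ν) : actD μ ν f Φ ∈ Xi := by
  set 𝒢 : Set (ℝ × ℝ → ℂ) := {h | ∃ f ∈ Xi, ∃ Φ ∈ SmoothVec c μ ν, h = actD μ ν f Φ}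
  have hG : ∀ {f Φ}, f ∈ Xi → Φ ∈ SmoothVec c μ ν → actD μ ν f Φ ∈ Submodule.span ℂ 𝒢 :=
    fun hf hΦ => Submodule.subset_span ⟨_, hf, _, hΦ, rfl⟩
  refine mem_Xi_of_class (Submodule.span ℂ 𝒢 : Set (ℝ × ℝ → ℂ)) (fun h hh => ?_) (fun h hh => ?_)
    (fun h hh => ?_) (hG hf hΦ)
  · induction hh using Submodule.span_induction with
    | mem h hh => obtain ⟨f, hf, Φ, hΦ, rfl⟩ := hh; exact actD_periodic hf hΦ
    | zero => simp
    | add h h' _ _ i i' => intro x y; simp only [Pi.add_apply, i, i']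
    | smul a h _ i => intro x y; simp only [Pi.smul_apply, i]
  · intro k
    induction hh using Submodule.span_induction with
    | mem h hh => obtain ⟨f, hf, Φ, hΦ, rfl⟩ := hh; exact actD_decay hf hΦ k
    | zero => exact ⟨0, by simp⟩
    | add h h' _ _ i i' =>
      obtain ⟨C, hC⟩ := i
      obtain ⟨C', hC'⟩ := i'
      refine ⟨C + C', fun m => ?_⟩
      calc _ ≤ |m.1| ^ k * (‖h m‖ + ‖h' m‖) :=
            mul_le_mul_of_nonneg_left (norm_add_le _ _) (by positivity)
        _ ≤ _ := by rw [mul_add]; exact add_le_add (hC m) (hC' m)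
    | smul a h _ i =>
      obtain ⟨C, hC⟩ := i
      refine ⟨‖a‖ * C, fun m => ?_⟩
      rw [Pi.smul_apply, norm_smul, mul_left_comm]
      exact mul_le_mul_of_nonneg_left (hC m) (norm_nonneg _)
  · induction hh using Submodule.span_induction with
    | mem h hh =>
      obtain ⟨f, hf, Φ, hΦ, rfl⟩ := hh
      have hP := numP_mem_SmoothVec hΦ
      exact ⟨_, add_mem (hG (pdx_mem_Xi hf) hΦ) (hG hf (famPdx_mem_SmoothVec hΦ)), _,
        sub_mem (sub_mem (hG (pdy_mem_Xi hf) hΦ) (Submodule.smul_mem _ _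
          (sub_mem (hG (coord_mul_mem_Xi hf) hP)
            (Submodule.smul_mem _ _ (hG hf (numP_mem_SmoothVec hP))))))
          (hG hf (famX_mem_SmoothVec hΦ)), hasPartials_actD hf hΦ⟩
    | zero =>
      refine ⟨0, zero_mem _, 0, zero_mem _, fun m => ?_⟩
      refine (hasFDerivAt_const (0 : ℂ) m).congr_fderiv ?_
      ext <;> simp
    | add h h' _ _ i i' =>
      obtain ⟨f₁, h1, f₂, h2, hp⟩ := i
      obtain ⟨g₁, k1, g₂, k2, hp'⟩ := i'
      exact ⟨_, add_mem h1 k1, _, add_mem h2 k2, hp.add hp'⟩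
    | smul a h _ i =>
      obtain ⟨f₁, h1, f₂, h2, hp⟩ := i
      exact ⟨_, Submodule.smul_mem _ a h1, _, Submodule.smul_mem _ a h2, hp.const_mul a⟩

/-- The Leibniz rule for `∇^0`. -/
theorem nablaZero_actD (hμ : μ ≠ 0) (V : heis) (hf : f ∈ Xi) (hΦ : Φ ∈ SmoothVec c μ ν) :
    nablaZero c μ V (actD μ ν f Φ) =
      fun m => actD μ ν (nablaZero c μ V f) Φ m + actD μ ν f (delta c μ V Φ) m := by
  funext m
  have hP := numP_mem_SmoothVec hΦ
  have hR := (hasSum_termA (nablaZero_mem_Xi c μ V hf) hΦ m).add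
    (hasSum_termA hf (delta_mem_SmoothVec V hΦ) m)
  have h0 := hasSum_termA hf hΦ m
  have hx := (hasSum_termA (pdx_mem_Xi hf) hΦ m).add (hasSum_termA hf (famPdx_mem_SmoothVec hΦ) m)
  have hy := ((hasSum_termA (pdy_mem_Xi hf) hΦ m).sub (((hasSum_termA (coord_mul_mem_Xi hf) hP m).sub
      ((hasSum_termA hf (numP_mem_SmoothVec hP) m).mul_left (μ : ℂ))).mul_left
        (2 * Real.pi * Complex.I * c))).sub (hasSum_termA hf (famX_mem_SmoothVec hΦ) m)
  have hL := (((hy.neg.add (h0.mul_left (Real.pi * c * Complex.I / (2 * μ) * m.1 ^ 2))).mul_left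
    (coordX V)).add (hx.neg.mul_left (coordY V))).add
      ((h0.mul_left (Real.pi * Complex.I * m.1 / μ)).mul_left (coordZ c V))
  have hμ' : (μ : ℂ) ≠ 0 := by exact_mod_cast hμ
  have hp := hasPartials_actD hf hΦ
  rw [nablaZero_eq]
  simp only [hp.pdx_eq, hp.pdy_eq]
  -- With x' = x + 2qμ, the X-part is (πci/2μ)(x'² - x²) = 2πic(qx' - q²μ).
  refine hasSum_unique hL hR fun q => ?_
  simp only [nablaZero_eq, delta_eq, termA, flow, numP, famX, famPdx, Pi.add_apply, Pi.smul_apply,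
    smul_eq_mul, coordX, coordY, coordZ, map_add, map_mul, map_neg,
    map_sub, map_intCast, Complex.conj_I, Complex.conj_ofReal, map_ofNat, map_natCast,
    Complex.ofReal_add, Complex.ofReal_mul, Complex.ofReal_natCast,
    Complex.ofReal_intCast, Complex.ofReal_ofNat]
  field_simp
  ring

end Action

/-! ### Algebraic identities of the bimodule -/

section Algebra

variable {c : ℕ} {μ ν : ℝ} {f g h R : ℝ × ℝ → ℂ} {Φ : ℝ × ℝ → ℤ → ℂ}

theorem innerD_eq_tsum (m : ℝ × ℝ) (p : ℤ) :
    innerD c μ ν f g m p = ∑' k, termD c μ ν f g m p k := rfl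

theorem adj_innerD : adj μ ν (innerD c μ ν f g) = innerD c μ ν g f := by
  funext m p
  rw [adj, innerD_eq_tsum, innerD_eq_tsum, Complex.conj_tsum]
  refine tsum_congr fun k => ?_
  have h1 : m.1 + 2 * ((-p : ℤ) : ℝ) * μ = m.1 - 2 * p * μ := by push_cast; ring
  have h2 : m.2 + 2 * ((-p : ℤ) : ℝ) * ν = m.2 - 2 * p * ν := by push_cast; ring
  have h3 : m.1 - 2 * p * μ - 2 * ((-p : ℤ) : ℝ) * μ = m.1 := by push_cast; ring
  have h4 : m.2 - 2 * p * ν - 2 * ((-p : ℤ) : ℝ) * ν = m.2 := by push_cast; ring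
  have h5 : (c * k * ((-p : ℤ) : ℝ) * (m.2 - 2 * p * ν - ((-p : ℤ) : ℝ) * ν) : ℝ) =
      -(c * k * p * (m.2 - p * ν)) := by push_cast; ring
  simp only [termD, flow, h1, h2, h3, h4, h5, map_mul, Complex.conj_conj, ← conj_e]
  ring

theorem innerD_add_right (hμ : μ ≠ 0) (hf : f ∈ Xi) (hg : g ∈ Xi) (hh : h ∈ Xi) :
    innerD c μ ν f (fun m => g m + h m) = innerD c μ ν f g + innerD c μ ν f h := by
  funext m p
  refine hasSum_unique (hasSum_termD hμ hf (add_mem_Xi hg hh) m p)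
    ((hasSum_termD hμ hf hg m p).add (hasSum_termD hμ hf hh m p)) fun k => ?_
  simp only [termD, map_add]; ring

theorem innerD_const_mul_right (a : ℂ) :
    innerD c μ ν f (fun m => a * g m) = conj a • innerD c μ ν f g := by
  funext m p
  simp only [Pi.smul_apply, innerD_eq_tsum, smul_eq_mul]
  rw [← tsum_mul_left]
  refine tsum_congr fun k => ?_
  simp only [termD, map_mul]; ring

theorem innerD_const_mul_left (a : ℂ) :
    innerD c μ ν (fun m => a * f m) g = a • innerD c μ ν f g := by
  funext m p
  simp only [Pi.smul_apply, innerD_eq_tsum, smul_eq_mul]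
  rw [← tsum_mul_left]
  refine tsum_congr fun k => ?_
  simp only [termD]; ring

theorem innerD_sub_right (hμ : μ ≠ 0) (hf : f ∈ Xi) (hg : g ∈ Xi) (hh : h ∈ Xi) :
    innerD c μ ν f (fun m => g m - h m) = innerD c μ ν f g - innerD c μ ν f h := by
  have := innerD_add_right (c := c) (ν := ν) hμ hf hg (const_mul_mem_Xi (-1) hh)
  rw [innerD_const_mul_right] at this
  simpa [sub_eq_add_neg] using this

theorem conv_smul_left (a : ℂ) (Φ Ψ : ℝ × ℝ → ℤ → ℂ) :
    conv μ ν (a • Φ) Ψ = a • conv μ ν Φ Ψ := by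
  funext m p
  simp only [conv, Pi.smul_apply, smul_eq_mul, ← tsum_mul_left, mul_assoc]

theorem conv_smul_right (a : ℂ) (Φ Ψ : ℝ × ℝ → ℤ → ℂ) :
    conv μ ν Φ (a • Ψ) = a • conv μ ν Φ Ψ := by
  funext m p
  simp only [conv, Pi.smul_apply, smul_eq_mul, ← tsum_mul_left, mul_left_comm a]

/-- The inner product is compatible with the right action: `⟨f, g · Φ⟩ = ⟨f, g⟩ ∗ Φ`. -/
theorem innerD_actD (hμ : μ ≠ 0) (hf : f ∈ Xi) (hg : g ∈ Xi) (hΦ : Φ ∈ SmoothVec c μ ν) :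
    innerD c μ ν f (actD μ ν g Φ) = conv μ ν (innerD c μ ν f g) Φ := by
  funext m p
  obtain ⟨B, hB⟩ := exists_bound_of_mem_SmoothVec hΦ
  obtain ⟨C, hC0, hC⟩ := exists_termD_le (c := c) (ν := ν) hμ hf hg
  set G : ℤ → ℤ → ℂ := fun k q => termD c μ ν f g m q k * Φ (flow μ ν (-q) m) (p - q) with hG
  have hsum : Summable (Function.uncurry G) := by
    refine Summable.of_norm_bounded (((summable_bw_add m.1).mul_of_nonneg summable_bw
      (fun _ => bw_nonneg _) (fun _ => bw_nonneg _)).mul_left (C * B)) ?_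
    rintro ⟨k, q⟩
    simp only [Function.uncurry, hG, norm_mul]
    calc _ ≤ (C * (bw (m.1 + k) * bw q)) * B :=
          mul_le_mul (hC m q k) (hB _ _) (norm_nonneg _)
            (mul_nonneg hC0 (mul_nonneg (bw_nonneg _) (bw_nonneg _)))
      _ = _ := by ring
  have h1 : innerD c μ ν f (actD μ ν g Φ) m p = ∑' k, ∑' q, G k q := by
    rw [innerD_eq_tsum]
    refine tsum_congr fun k => ?_
    rw [termD]
    change _ * conj (∑' q, termA μ ν g Φ (m.1 - 2 * p * μ + k, m.2 - 2 * p * ν) q) = _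
    rw [Complex.conj_tsum, ← (Equiv.subLeft p).tsum_eq, ← tsum_mul_left]
    refine tsum_congr fun q => ?_
    have e1 : m.1 - 2 * p * μ + k + 2 * ((p - q : ℤ) : ℝ) * μ = m.1 - 2 * q * μ + k := by
      push_cast; ring
    have e2 : m.2 - 2 * p * ν + 2 * ((p - q : ℤ) : ℝ) * ν = m.2 - 2 * q * ν := by
      push_cast; ring
    have e3 : m.1 + 2 * ((-q : ℤ) : ℝ) * μ = m.1 - 2 * q * μ := by push_cast; ring
    have e4 : m.2 + 2 * ((-q : ℤ) : ℝ) * ν = m.2 - 2 * q * ν := by push_cast; ring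
    -- Covariance of Φ removes the translation by k; the combined phase is the one of degree q since
    -- (p - q)(y - (p + q)ν) + q(y - qν) = p(y - pν).
    have e5 : conj (e (c * k * p * (m.2 - p * ν))) * e (c * k * ((p - q : ℤ) : ℝ) *
        (m.2 - 2 * q * ν - ((p - q : ℤ) : ℝ) * ν)) = conj (e (c * k * q * (m.2 - q * ν))) := by
      rw [conj_e, conj_e, ← e_add]; congr 1; push_cast; ring
    simp only [hG, termA, termD, flow, Equiv.subLeft_apply, map_mul, Complex.conj_conj, e1, e2, e3,
      e4, hΦ.1.2, ← e5]
    ring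
  rw [h1, ← hsum.tsum_comm, conv]
  refine tsum_congr fun q => ?_
  rw [innerD_eq_tsum, ← tsum_mul_right]

/-- A function `R` with `⟨R, R⟩_E = 1` satisfies `R · ⟨R, g⟩_D = g`. -/
theorem actD_innerD (hμ : μ ≠ 0) (hR : R ∈ Xi) (hRE : innerE c μ ν R R = idE) (hg : g ∈ Xi) :
    actD μ ν R (innerD c μ ν R g) = g := by
  funext m
  obtain ⟨B, hB⟩ := decay_one_add_of_mem_Xi 2 hR
  obtain ⟨C, hC0, hC⟩ := exists_termD_le (c := c) (ν := ν) hμ hR hg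
  set H : ℤ → ℤ → ℂ := fun q k =>
    R (flow μ ν q m) * conj (termD c μ ν R g (flow μ ν q m) q k) with hH
  have hsum : Summable (Function.uncurry H) := by
    refine Summable.of_norm_bounded ((summable_bw.mul_of_nonneg summable_bw
      (fun _ => bw_nonneg _) (fun _ => bw_nonneg _)).mul_left (C * B)) ?_
    rintro ⟨q, k⟩
    simp only [Function.uncurry, hH, norm_mul, Complex.norm_conj]
    have h1 := hC (flow μ ν q m) q k
    have h2 := hB (flow μ ν q m)
    have h3 := bw_add_le (flow μ ν q m).1 k
    rw [add_comm] at h3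
    have hw : 0 ≤ C * bw q * bw k := mul_nonneg (mul_nonneg hC0 (bw_nonneg _)) (bw_nonneg _)
    calc _ ≤ ‖R (flow μ ν q m)‖ * (C * ((1 + |(flow μ ν q m).1|) ^ 2 * bw k * bw q)) := by
          refine mul_le_mul_of_nonneg_left (h1.trans ?_) (norm_nonneg _)
          exact mul_le_mul_of_nonneg_left (mul_le_mul_of_nonneg_right h3 (bw_nonneg _)) hC0
      _ = ((1 + |(flow μ ν q m).1|) ^ 2 * ‖R (flow μ ν q m)‖) * (C * bw q * bw k) := by ring
      _ ≤ B * (C * bw q * bw k) := mul_le_mul_of_nonneg_right h2 hw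
      _ = _ := by ring
  have h1 : actD μ ν R (innerD c μ ν R g) m = ∑' q, ∑' k, H q k := by
    refine tsum_congr fun q => ?_
    rw [innerD_eq_tsum, Complex.conj_tsum, ← tsum_mul_left]
  -- Summed over q first, after q ↦ -q, the two factors of `R` form the conjugate of ⟨R, R⟩_E,
  -- leaving only k = 0.
  have h2 : ∀ k, ∑' q, H q k = conj (idE m k) * g (m.1 + k, m.2) := by
    intro k
    rw [← hRE, innerE, Complex.conj_tsum, ← tsum_mul_right, ← (Equiv.neg ℤ).tsum_eq]
    refine tsum_congr fun q => ?_
    have e1 : m.1 + 2 * ((-q : ℤ) : ℝ) * μ = m.1 - 2 * q * μ := by push_cast; ring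
    have e2 : m.2 + 2 * ((-q : ℤ) : ℝ) * ν = m.2 - 2 * q * ν := by push_cast; ring
    have e3 : m.1 - 2 * q * μ - 2 * ((-q : ℤ) : ℝ) * μ = m.1 := by push_cast; ring
    have e4 : m.2 - 2 * q * ν - 2 * ((-q : ℤ) : ℝ) * ν = m.2 := by push_cast; ring
    have e5 : (c * k * ((-q : ℤ) : ℝ) * (m.2 - 2 * q * ν - ((-q : ℤ) : ℝ) * ν) : ℝ) =
        -(c * k * q * (m.2 - q * ν)) := by push_cast; ring
    simp only [hH, termD, flow, Equiv.neg_apply, map_mul, Complex.conj_conj, e1, e2, e3, e4, e5,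
      conj_e]
    ring_nf
  rw [h1, ← hsum.tsum_comm, tsum_congr h2, tsum_eq_single 0 (fun k hk => by simp [idE, hk])]
  simp [idE]

theorem conv_assoc {Φ Ψ Χ : ℝ × ℝ → ℤ → ℂ} (hΦ : HasBwBound Φ) (hΨ : HasBwBound Ψ)
    (hΧ : HasBwBound Χ) : conv μ ν (conv μ ν Φ Ψ) Χ = conv μ ν Φ (conv μ ν Ψ Χ) := by
  obtain ⟨A, hA0, hA⟩ := hΦ
  obtain ⟨B, hB0, hB⟩ := hΨ
  obtain ⟨C, hC0, hC⟩ := hΧ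
  funext m p
  set K : ℤ → ℤ → ℂ := fun r q =>
    Φ m r * Ψ (flow μ ν (-r) m) (q - r) * Χ (flow μ ν (-q) m) (p - q) with hK
  have hsum : Summable (Function.uncurry K) := by
    have hs : Summable fun x : ℤ × ℤ => bw x.1 * bw x.2 :=
      summable_bw.mul_of_nonneg summable_bw (fun _ => bw_nonneg _) (fun _ => bw_nonneg _)
    -- The shear (r, q) ↦ (r, q - r) turns the majorant into a product of two summable weights.
    have hs' := (Equiv.prodShear (Equiv.refl ℤ) fun r : ℤ => Equiv.subRight r).summable_iff.2 hs
    refine Summable.of_norm_bounded (hs'.mul_left (A * B * C)) ?_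
    rintro ⟨r, q⟩
    simp only [Function.uncurry, hK, norm_mul, Function.comp, Equiv.prodShear_apply,
      Equiv.refl_apply, Equiv.subRight_apply]
    have h3 : ‖Χ (flow μ ν (-q) m) (p - q)‖ ≤ C :=
      (hC _ _).trans (mul_le_of_le_one_right hC0 (bw_le_one _))
    have hr := bw_nonneg (r : ℝ)
    have hqr := bw_nonneg ((q - r : ℤ) : ℝ)
    calc _ ≤ (A * bw r) * (B * bw (q - r : ℤ)) * C :=
          mul_le_mul (mul_le_mul (hA _ _) (hB _ _) (norm_nonneg _) (by positivity)) h3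
            (norm_nonneg _) (by positivity)
      _ = _ := by ring
  have h1 : conv μ ν (conv μ ν Φ Ψ) Χ m p = ∑' q, ∑' r, K r q := by
    refine tsum_congr fun q => ?_
    rw [conv, ← tsum_mul_right]
  have h2 : conv μ ν Φ (conv μ ν Ψ Χ) m p = ∑' r, ∑' q, K r q := by
    refine tsum_congr fun r => ?_
    rw [conv, ← tsum_mul_left, ← (Equiv.subRight r).tsum_eq]
    refine tsum_congr fun q => ?_
    have e1 : -r + -(q - r) = -q := by ring
    have e2 : p - r - (q - r) = p - q := by ring
    simp only [hK, Equiv.subRight_apply, flow_flow, e1, e2, mul_assoc]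
  rw [h1, h2, hsum.tsum_comm]

end Algebra

/-! ### Linearity and curvature of `∇^0` -/

section Curvature

variable {c : ℕ} {μ ν : ℝ} {f g : ℝ × ℝ → ℂ}

theorem nablaZero_add (V : heis) (hf : f ∈ Xi) (hg : g ∈ Xi) :
    nablaZero c μ V (fun m => f m + g m) =
      fun m => nablaZero c μ V f m + nablaZero c μ V g m := by
  have h := (hasPartials_of_mem_Xi hf).add (hasPartials_of_mem_Xi hg)
  funext m
  simp only [nablaZero_eq, h.pdx_eq, h.pdy_eq]; ring

theorem nablaZero_const_mul (V : heis) (a : ℂ) (hf : f ∈ Xi) :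
    nablaZero c μ V (fun m => a * f m) = fun m => a * nablaZero c μ V f m := by
  have h := (hasPartials_of_mem_Xi hf).const_mul a
  funext m
  simp only [nablaZero_eq, h.pdx_eq, h.pdy_eq]; ring

theorem nablaZero_add_left (V W : heis) :
    nablaZero c μ (V + W) f = fun m => nablaZero c μ V f m + nablaZero c μ W f m := by
  funext m
  simp only [nablaZero_eq, coordX, coordY, coordZ, Submodule.coe_add, Matrix.add_apply]
  push_cast; ring

theorem nablaZero_smul_left (r : ℝ) (V : heis) :
    nablaZero c μ (r • V) f = fun m => (r : ℂ) * nablaZero c μ V f m := by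
  funext m
  simp only [nablaZero_eq, coordX, coordY, coordZ, Submodule.coe_smul, Matrix.smul_apply,
    smul_eq_mul]
  push_cast; ring

theorem coordX_bracket (V W : heis) : coordX (bracket V W) = 0 := by
  simp [coordX, bracket, Matrix.mul_apply, Fin.sum_univ_three, V.2 0 0 le_rfl, V.2 1 1 le_rfl,
    V.2 2 1 (by decide), W.2 0 0 le_rfl, W.2 1 1 le_rfl, W.2 2 1 (by decide)]

theorem coordY_bracket (V W : heis) : coordY (bracket V W) = 0 := by
  simp [coordY, bracket, Matrix.mul_apply, Fin.sum_univ_three, V.2 1 0 (by decide),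
    V.2 1 1 le_rfl, V.2 2 2 le_rfl, W.2 1 0 (by decide), W.2 1 1 le_rfl, W.2 2 2 le_rfl]

theorem coordZ_bracket (V W : heis) :
    coordZ c (bracket V W) = c * (coordX V * coordY W - coordX W * coordY V) := by
  simp [coordX, coordY, coordZ, bracket, Matrix.mul_apply, Fin.sum_univ_three, V.2 0 0 le_rfl,
    V.2 2 2 le_rfl, W.2 0 0 le_rfl, W.2 2 2 le_rfl]

/-- The curvature coefficient of `∇'`. -/
def curvCoeff (c : ℕ) (μ : ℝ) (V W : heis) : ℂ :=
  (coordY V * coordZ c W - coordZ c V * coordY W) * (Real.pi * Complex.I / μ)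

theorem conj_curvCoeff (V W : heis) : conj (curvCoeff c μ V W) = -curvCoeff c μ V W := by
  simp only [curvCoeff, coordY, coordZ, map_mul, map_sub, map_div₀, Complex.conj_ofReal,
    Complex.conj_I]
  ring

theorem hasPartials_nablaZero (V : heis) (hf : f ∈ Xi) : HasPartials (nablaZero c μ V f)
    (fun m => coordX V * (-pdx (pdy f) m + Real.pi * c * Complex.I / (2 * μ) *
        (2 * m.1 * f m + m.1 ^ 2 * pdx f m)) + coordY V * (-pdx (pdx f) m)
        + coordZ c V * (Real.pi * Complex.I / μ * (f m + m.1 * pdx f m)))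
    (fun m => coordX V * (-pdy (pdy f) m + Real.pi * c * Complex.I / (2 * μ) *
        (m.1 ^ 2 * pdy f m)) + coordY V * (-pdx (pdy f) m)
        + coordZ c V * (Real.pi * Complex.I / μ * (m.1 * pdy f m))) := by
  have h0 := hasPartials_of_mem_Xi hf
  have hx := hasPartials_of_mem_Xi (pdx_mem_Xi hf)
  have hy := hasPartials_of_mem_Xi (pdy_mem_Xi hf)
  have h1 := HasPartials.coord.mul h0
  have h2 := HasPartials.coord.mul h1
  have h := ((((hy.const_mul (-1)).add (h2.const_mul (Real.pi * c * Complex.I / (2 * μ)))).const_mul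
    (coordX V)).add ((hx.const_mul (-1)).const_mul (coordY V))).add
    ((h1.const_mul (Real.pi * Complex.I / μ)).const_mul (coordZ c V))
  have he : nablaZero c μ V f = _ := nablaZero_eq c μ V f
  have hf' : (fun m : ℝ × ℝ => coordX V * (-1 * pdy f m + Real.pi * c * Complex.I / (2 * μ) *
      (m.1 * (m.1 * f m))) + coordY V * (-1 * pdx f m) +
      coordZ c V * (Real.pi * Complex.I / μ * (m.1 * f m))) = nablaZero c μ V f := by
    rw [he]; funext m; ring
  rw [hf'] at h
  refine h.of_eq (fun m => by ring) (fun m => ?_)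
  -- Mixed derivatives are put in a single order so that they cancel in the commutator.
  rw [pdx_pdy_comm hf.1]; ring

/-- The curvature of `∇^0` is scalar. -/
theorem nablaZero_curvature (hμ : μ ≠ 0) (V W : heis) (hf : f ∈ Xi) (m : ℝ × ℝ) :
    nablaZero c μ V (nablaZero c μ W f) m - nablaZero c μ W (nablaZero c μ V f) m
      - nablaZero c μ (bracket V W) f m = -curvCoeff c μ V W * f m := by
  have hV := hasPartials_nablaZero (c := c) (μ := μ) V hf
  have hW := hasPartials_nablaZero (c := c) (μ := μ) W hf
  have hμ' : (μ : ℂ) ≠ 0 := by exact_mod_cast hμ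
  rw [nablaZero_eq c μ V (nablaZero c μ W f), nablaZero_eq c μ W (nablaZero c μ V f), hV.pdx_eq,
    hV.pdy_eq, hW.pdx_eq, hW.pdy_eq]
  simp only [nablaZero_eq, coordX_bracket,
    coordY_bracket, coordZ_bracket, curvCoeff]
  field_simp
  ring

end Curvature

/-! ### The transported connection -/

section Transport

variable {c : ℕ} {μ ν : ℝ} {R ξ η : ℝ × ℝ → ℂ} {Φ f : ℝ × ℝ → ℤ → ℂ}

/-- Q ∗ F(ξ) = F(R·F(ξ)) = F(ξ); the case ξ = R says that Q is idempotent. -/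
theorem conv_innerD_self (hc : 0 < c) (hμ : μ ≠ 0) (hR : R ∈ Xi)
    (hRE : innerE c μ ν R R = idE) (hξ : ξ ∈ Xi) :
    conv μ ν (innerD c μ ν R R) (innerD c μ ν R ξ) = innerD c μ ν R ξ := by
  rw [← innerD_actD hμ hR hR (mem_SmoothVec_of_mem_DSmooth (innerD_mem_DSmooth hc hμ hR hξ)),
    actD_innerD hμ hR hRE hξ]

/-- ⟨ξ, R⟩_D ∗ ⟨R, η⟩_D = ⟨ξ, R·⟨R, η⟩_D⟩_D = ⟨ξ, η⟩_D. -/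
theorem innerD_eq_conv (hc : 0 < c) (hμ : μ ≠ 0) (hR : R ∈ Xi)
    (hRE : innerE c μ ν R R = idE) (hξ : ξ ∈ Xi) (hη : η ∈ Xi) :
    innerD c μ ν ξ η = conv μ ν (adj μ ν (innerD c μ ν R ξ)) (innerD c μ ν R η) := by
  rw [adj_innerD, ← innerD_actD hμ hξ hR
    (mem_SmoothVec_of_mem_DSmooth (innerD_mem_DSmooth hc hμ hR hη)), actD_innerD hμ hR hRE hη]

theorem mem_QD_iff (hc : 0 < c) (hμ : μ ≠ 0) (hR : R ∈ Xi) (hRE : innerE c μ ν R R = idE) :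
    f ∈ QD c μ ν (innerD c μ ν R R) ↔ ∃ ξ ∈ Xi, innerD c μ ν R ξ = f := by
  constructor
  · rintro ⟨d, hd, rfl⟩
    have hd' := mem_SmoothVec_of_mem_DSmooth hd
    exact ⟨_, actD_mem_Xi hR hd', innerD_actD hμ hR hR hd'⟩
  · rintro ⟨ξ, hξ, rfl⟩
    exact ⟨_, innerD_mem_DSmooth hc hμ hR hξ, (conv_innerD_self hc hμ hR hRE hξ).symm⟩

theorem injOn_innerD (hμ : μ ≠ 0) (hR : R ∈ Xi) (hRE : innerE c μ ν R R = idE) :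
    Set.InjOn (innerD c μ ν R) Xi := fun ξ hξ η hη h => by
  rw [← actD_innerD hμ hR hRE hξ, h, actD_innerD hμ hR hRE hη]

theorem nablaPrime_innerD (hμ : μ ≠ 0) (hR : R ∈ Xi) (hRE : innerE c μ ν R R = idE)
    (V : heis) (hξ : ξ ∈ Xi) :
    nablaPrime c μ ν R V (innerD c μ ν R ξ) = innerD c μ ν R (nablaZero c μ V ξ) := by
  have hex : ∃ a ∈ Xi, innerD c μ ν R a = innerD c μ ν R ξ := ⟨ξ, hξ, rfl⟩
  rw [nablaPrime, injOn_innerD hμ hR hRE (Function.invFunOn_mem hex) hξ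
    (Function.invFunOn_eq hex)]

theorem isCompatibleConnection_nablaPrime (hc : 0 < c) (hμ : μ ≠ 0) (hR : R ∈ Xi)
    (hRE : innerE c μ ν R R = idE) :
    IsCompatibleConnection c μ ν (QD c μ ν (innerD c μ ν R R)) (conv μ ν)
      (fun f g => conv μ ν (adj μ ν f) g) (nablaPrime c μ ν R) := by
  have hQ := fun {f} => mem_QD_iff (f := f) hc hμ hR hRE
  have hN := fun {ξ} V => nablaPrime_innerD (ξ := ξ) hμ hR hRE V
  have hadd : ∀ {ξ η}, ξ ∈ Xi → η ∈ Xi → innerD c μ ν R ξ + innerD c μ ν R η =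
    innerD c μ ν R (fun m => ξ m + η m) := fun hξ hη => (innerD_add_right hμ hR hξ hη).symm
  -- F is conjugate linear, so a scalar enters `Xi` conjugated and leaves it unchanged.
  have hmul : ∀ (a : ℂ) ξ, a • innerD c μ ν R ξ = innerD c μ ν R (fun m => conj a * ξ m) := by
    intro a ξ; rw [innerD_const_mul_right, Complex.conj_conj]
  constructor
  · intro V f hf
    obtain ⟨ξ, hξ, rfl⟩ := hQ.1 hf
    rw [hN V hξ]
    exact hQ.2 ⟨_, nablaZero_mem_Xi c μ V hξ, rfl⟩
  · intro V f hf g hg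
    obtain ⟨ξ, hξ, rfl⟩ := hQ.1 hf
    obtain ⟨η, hη, rfl⟩ := hQ.1 hg
    rw [hadd hξ hη, hN V (add_mem_Xi hξ hη), hN V hξ, hN V hη, nablaZero_add V hξ hη,
      hadd (nablaZero_mem_Xi c μ V hξ) (nablaZero_mem_Xi c μ V hη)]
  · intro V a f hf
    obtain ⟨ξ, hξ, rfl⟩ := hQ.1 hf
    rw [hmul, hN V (const_mul_mem_Xi _ hξ), hN V hξ, nablaZero_const_mul V _ hξ, hmul]
  · intro V W f hf
    obtain ⟨ξ, hξ, rfl⟩ := hQ.1 hf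
    rw [hN _ hξ, hN V hξ, hN W hξ, nablaZero_add_left,
      hadd (nablaZero_mem_Xi c μ V hξ) (nablaZero_mem_Xi c μ W hξ)]
  · intro r V f hf
    obtain ⟨ξ, hξ, rfl⟩ := hQ.1 hf
    rw [hN _ hξ, hN V hξ, nablaZero_smul_left, hmul, Complex.conj_ofReal]
  · intro V f hf Φ hΦ
    obtain ⟨ξ, hξ, rfl⟩ := hQ.1 hf
    have hΦ' := mem_SmoothVec_of_mem_DSmooth hΦ
    have hδ := delta_mem_SmoothVec V hΦ'
    rw [← innerD_actD hμ hR hξ hΦ', hN V (actD_mem_Xi hξ hΦ'), hN V hξ,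
      nablaZero_actD hμ V hξ hΦ', ← innerD_actD hμ hR (nablaZero_mem_Xi c μ V hξ) hΦ',
      ← innerD_actD hμ hR hξ hδ,
      hadd (actD_mem_Xi (nablaZero_mem_Xi c μ V hξ) hΦ') (actD_mem_Xi hξ hδ)]
  · intro V f hf g hg
    obtain ⟨ξ, hξ, rfl⟩ := hQ.1 hf
    obtain ⟨η, hη, rfl⟩ := hQ.1 hg
    have hξ' := nablaZero_mem_Xi c μ V hξ
    have hη' := nablaZero_mem_Xi c μ V hη
    simp only [hN V hξ, hN V hη, ← innerD_eq_conv hc hμ hR hRE hξ hη,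
      ← innerD_eq_conv hc hμ hR hRE hξ' hη, ← innerD_eq_conv hc hμ hR hRE hξ hη']
    exact delta_innerD hμ V hξ hη

/-- The scalar -κ of ∇^0 becomes its conjugate under F, which is κ because κ is imaginary; Q acts as
the identity on the range of F. -/
theorem curvOp_nablaPrime (hc : 0 < c) (hμ : μ ≠ 0) (hR : R ∈ Xi)
    (hRE : innerE c μ ν R R = idE) (V W : heis) (hξ : ξ ∈ Xi) :
    curvOp (nablaPrime c μ ν R) V W (innerD c μ ν R ξ) =
      conv μ ν (curvCoeff c μ V W • innerD c μ ν R R) (innerD c μ ν R ξ) := by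
  have hV := nablaZero_mem_Xi c μ V hξ
  have hW := nablaZero_mem_Xi c μ W hξ
  have hVW := nablaZero_mem_Xi c μ V hW
  have hWV := nablaZero_mem_Xi c μ W hV
  have hsub : (fun m => nablaZero c μ V (nablaZero c μ W ξ) m -
      nablaZero c μ W (nablaZero c μ V ξ) m) ∈ Xi := by
    have := add_mem_Xi hVW (neg_mem_Xi hWV)
    simpa only [← sub_eq_add_neg] using this
  have hN := fun {ξ} V => nablaPrime_innerD (ξ := ξ) hμ hR hRE V
  rw [curvOp, hN V hξ, hN W hξ, hN V hW, hN W hV, hN _ hξ, ← innerD_sub_right hμ hR hVW hWV,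
    ← innerD_sub_right hμ hR hsub (nablaZero_mem_Xi c μ _ hξ),
    funext (nablaZero_curvature hμ V W hξ), innerD_const_mul_right, map_neg, conj_curvCoeff,
    neg_neg, conv_smul_left, conv_innerD_self hc hμ hR hRE hξ]

theorem smul_innerD_mem_QDQ (hc : 0 < c) (hμ : μ ≠ 0) (hR : R ∈ Xi)
    (hRE : innerE c μ ν R R = idE) (a : ℂ) :
    a • innerD c μ ν R R ∈ QDQ c μ ν (innerD c μ ν R R) := by
  refine ⟨a • innerD c μ ν R R, ?_, ?_⟩
  · rw [← innerD_const_mul_left]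
    exact innerD_mem_DSmooth hc hμ (const_mul_mem_Xi a hR) hR
  · simp only [conv_smul_right, conv_smul_left, conv_innerD_self hc hμ hR hRE hR]

/-- Q ∗ d = ⟨R, R·d⟩_D is itself an inner product, which supplies the decay needed for
associativity. -/
theorem conv_eq_self_of_mem_QDQ (hc : 0 < c) (hμ : μ ≠ 0) (hR : R ∈ Xi)
    (hRE : innerE c μ ν R R = idE) (hf : f ∈ QDQ c μ ν (innerD c μ ν R R)) :
    conv μ ν f (innerD c μ ν R R) = f := by
  obtain ⟨d, hd, rfl⟩ := hf
  have hd' := mem_SmoothVec_of_mem_DSmooth hd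
  have hQ := hasBwBound_innerD (c := c) (ν := ν) hμ hR hR
  rw [← innerD_actD hμ hR hR hd',
    conv_assoc (hasBwBound_innerD hμ hR (actD_mem_Xi hR hd')) hQ hQ,
    conv_innerD_self hc hμ hR hRE hR]

end Transport

end QHM

end

/-! ### Assembly of the projection, the module isomorphism, the connection and its curvature. -/

theorem mainTheorem8 (c : ℕ) (hc : 0 < c) (μ ν : ℝ) (hμ : μ ≠ 0)
    (R : ℝ × ℝ → ℂ) (hR : R ∈ QHM.Xi) (hRE : QHM.innerE c μ ν R R = QHM.idE)
    (Q : ℝ × ℝ → ℤ → ℂ) (hQ : Q = QHM.innerD c μ ν R R) :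
    -- `Q` is a projection in the smooth algebra
    (Q ∈ QHM.DSmooth c μ ν ∧ QHM.conv μ ν Q Q = Q ∧ QHM.adj μ ν Q = Q) ∧
    -- `F ξ = ⟨R, ξ⟩_D` is an isomorphism of right Hermitian modules, with inverse `f ↦ R · f`
    (Set.BijOn (QHM.innerD c μ ν R) QHM.Xi (QHM.QD c μ ν Q) ∧
      Set.InvOn (QHM.actD μ ν R) (QHM.innerD c μ ν R) QHM.Xi (QHM.QD c μ ν Q) ∧
      (∀ ξ ∈ QHM.Xi, ∀ Φ ∈ QHM.DSmooth c μ ν, QHM.actD μ ν ξ Φ ∈ QHM.Xi ∧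
        QHM.innerD c μ ν R (QHM.actD μ ν ξ Φ) = QHM.conv μ ν (QHM.innerD c μ ν R ξ) Φ) ∧
      (∀ ξ ∈ QHM.Xi, ∀ η ∈ QHM.Xi, QHM.innerD c μ ν ξ η =
        QHM.conv μ ν (QHM.adj μ ν (QHM.innerD c μ ν R ξ)) (QHM.innerD c μ ν R η))) ∧
    -- the transported connection is compatible, and its formula
    (QHM.IsCompatibleConnection c μ ν (QHM.QD c μ ν Q) (QHM.conv μ ν)
        (fun f g => QHM.conv μ ν (QHM.adj μ ν f) g) (QHM.nablaPrime c μ ν R) ∧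
      ∀ V : QHM.heis, ∀ f ∈ QHM.QD c μ ν Q, QHM.nablaPrime c μ ν R V f =
        QHM.innerD c μ ν R (QHM.nablaZero c μ V (QHM.actD μ ν R f))) ∧
    -- its curvature: a unique form with values in `Q D^∞ Q`, and its values on the basis
    ∃ Θ : QHM.heis → QHM.heis → (ℝ × ℝ → ℤ → ℂ),
      (∀ V W, Θ V W ∈ QHM.QDQ c μ ν Q ∧ ∀ f ∈ QHM.QD c μ ν Q,
        QHM.curvOp (QHM.nablaPrime c μ ν R) V W f = QHM.conv μ ν (Θ V W) f) ∧
      (∀ V W, ∀ T ∈ QHM.QDQ c μ ν Q, (∀ f ∈ QHM.QD c μ ν Q,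
        QHM.curvOp (QHM.nablaPrime c μ ν R) V W f = QHM.conv μ ν T f) → T = Θ V W) ∧
      Θ QHM.basisX QHM.basisY = 0 ∧
      Θ QHM.basisX (QHM.basisZ c) = 0 ∧
      Θ QHM.basisY (QHM.basisZ c) = (Real.pi * Complex.I / μ : ℂ) • Q := by
  subst hQ
  have hQQ := fun {f} => QHM.mem_QD_iff (f := f) hc hμ hR hRE
  have hRR := QHM.innerD_mem_DSmooth (ν := ν) hc hμ hR hR
  have hQself := QHM.conv_innerD_self hc hμ hR hRE hR
  refine ⟨⟨hRR, hQself, QHM.adj_innerD⟩, ⟨?_, ⟨?_, ?_⟩, ?_, ?_⟩,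
    ⟨QHM.isCompatibleConnection_nablaPrime hc hμ hR hRE, ?_⟩,
    fun V W => QHM.curvCoeff c μ V W • QHM.innerD c μ ν R R, ?_, ?_, ?_, ?_, ?_⟩
  · exact ⟨fun ξ hξ => hQQ.2 ⟨ξ, hξ, rfl⟩, QHM.injOn_innerD hμ hR hRE, fun f hf => hQQ.1 hf⟩
  · exact fun ξ hξ => QHM.actD_innerD hμ hR hRE hξ
  · intro f hf
    obtain ⟨ξ, hξ, rfl⟩ := hQQ.1 hf
    rw [QHM.actD_innerD hμ hR hRE hξ]
  · intro ξ hξ Φ hΦ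
    have hΦ' := QHM.mem_SmoothVec_of_mem_DSmooth hΦ
    exact ⟨QHM.actD_mem_Xi hξ hΦ', QHM.innerD_actD hμ hR hξ hΦ'⟩
  · exact fun ξ hξ η hη => QHM.innerD_eq_conv hc hμ hR hRE hξ hη
  · intro V f hf
    obtain ⟨ξ, hξ, rfl⟩ := hQQ.1 hf
    rw [QHM.nablaPrime_innerD hμ hR hRE V hξ, QHM.actD_innerD hμ hR hRE hξ]
  · intro V W
    refine ⟨QHM.smul_innerD_mem_QDQ hc hμ hR hRE _, fun f hf => ?_⟩
    obtain ⟨ξ, hξ, rfl⟩ := hQQ.1 hf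
    exact QHM.curvOp_nablaPrime hc hμ hR hRE V W hξ
  · intro V W T hT h
    -- Test on f = Q = F(R): the left side is the scalar times Q, and the right side is T ∗ Q = T.
    have h1 := h _ (hQQ.2 ⟨R, hR, rfl⟩)
    rw [QHM.curvOp_nablaPrime hc hμ hR hRE V W hR, QHM.conv_smul_left, hQself,
      QHM.conv_eq_self_of_mem_QDQ hc hμ hR hRE hT] at h1
    exact h1.symm
  · simp [QHM.curvCoeff]
  · simp [QHM.curvCoeff]
  · simp [QHM.curvCoeff, QHM.coordZ_basisZ hc]
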